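/- **Setting.** Let $p\neq q$ be points of the $x$-axis in $\mathbb R^2$ and $L:=|p-q|$. Let $X$ be the set of pairs $(\Upsilon,\kappa_\Upsilon)$ where $\Upsilon\in H^2([0,L];\mathbb R^2)$ has constant speed $|\partial_x\Upsilon|=\ell(\Upsilon)/L$, with $\ell(\Upsilon)=\int_0^L|\partial_x\Upsilon|\,dx$, satisfies $\Upsilon(0)=p$, $\Upsilon(L)=q$, and its tangent vectors $\partial_x\Upsilon(0)$ and $\partial_x\Upsilon(L)$ are horizontal and point in the direction of $q-p$; and where $\kappa_\Upsilon=\frac{L}{\ell(\Upsilon)}\,\partial_x\theta$ is the signed curvature, $\theta\in H^1([0,L])$ being a lifting of the tangent, $\partial_x\Upsilon=\frac{\ell(\Upsilon)}{L}(\cos\theta,\sin\theta)$. For $\varepsilon>0$ put $$G_\varepsilon(\Upsilon)=\varepsilon^{1/2}\,\frac{\ell(\Upsilon)}{L}\int_0^L\kappa_\Upsilon^2\,dx+\varepsilon^{-1/2}\bigl(\ell(\Upsilon)-|p-q|\bigr).$$ The flat norm of a finite signed Borel measure $\mu$ on $[0,L]$ is the supremum of $\int_{[0,L]}\varphi\,d\mu$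 over Lipschitz $\varphi:[0,L]\to\mathbb R$ with $\|\varphi\|_\infty+\mathrm{Lip}(\varphi)\le 1$. Pairs $(\Upsilon_n,\mu_n)$ converge to $(\Upsilon,\mu)$ if $\Upsilon_n\to\Upsilon$ in $H^1([0,L];\mathbb R^2)$ and $\mu_n\to\mu$ in the flat norm; $\kappa_\Upsilon$ is identified with the measure $\kappa_\Upsilon\,dx$. A *pointed segment* is a pair $(\Upsilon,\mu)$ with $\Upsilon(x)=p+\frac xL(q-p)$ on $[0,L]$ and $\mu=2\pi\sum_{j=1}^N c_j\delta_{x_j}$, where $N\ge 0$, $0\le x_1<\dots<x_N\le L$, $c_j\in\mathbb Z$. Set $G(\Upsilon,\mu)=\sum_{j=1}^N|c_j|$ if $(\Upsilon,\mu)$ is a pointed segment, and $G(\Upsilon,\mu)=+\infty$ for every other pair of a curve $\Upsilon\in H^1([0,L];\mathbb R^2)$ and a finite signed Borel measure $\mu$ on $[0,L]$. **Theorem.** (i) *Compactness.* Let $\varepsilon_n\to0^+$ and $(\Upsilon_n,\kappa_{\Upsilon_n})\in X$ with $\sup_n G_{\varepsilon_n}(\Upsilon_n)<+\infty$. Then a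 subsequence of $(\Upsilon_n,\kappa_{\Upsilon_n})$ converges to a pointed segment. (i') *Lower bound.* Let $\varepsilon_n\to0^+$ and let $(\Upsilon_n,\kappa_{\Upsilon_n})\in X$ converge to $(\Upsilon,\mu)$, where $\Upsilon\in H^1([0,L];\mathbb R^2)$ and $\mu$ is a finite signed Borel measure on $[0,L]$. Then $$\liminf_{n\to\infty}G_{\varepsilon_n}(\Upsilon_n)\ \ge\ 8\sqrt2\;G(\Upsilon,\mu).$$ (ii) *Recovery.* For every pointed segment $(\Upsilon,\mu)$ there are pairs $(\Upsilon_\varepsilon,\kappa_{\Upsilon_\varepsilon})\in X$, $\varepsilon\in(0,1]$, which converge to $(\Upsilon,\mu)$ as $\varepsilon\to0^+$ and satisfy $$\lim_{\varepsilon\to0^+}G_\varepsilon(\Upsilon_\varepsilon)=8\sqrt2\;G(\Upsilon,\mu).$$ -/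

import Mathlib

open MeasureTheory Filter Topology Set
open scoped ENNReal

noncomputable section

namespace PointedCurve

/-- The plane with its Euclidean norm. -/
abbrev Plane : Type := EuclideanSpace ℝ (Fin 2)

section Sobolev

variable {F : Type*} [NormedAddCommGroup F] [NormedSpace ℝ F]

/-- The derivative `∂ₓ f` of a function on `[0, L]` (one-sided at the endpoints; values of `f`
outside `[0, L]` play no role). -/
def dx (L : ℝ) (f : ℝ → F) (x : ℝ) : F := derivWithin f (Icc 0 L) x

/-- `f ∈ H¹([0, L]; F)`, for the continuous representative `f`: the function is absolutely
continuous (it is the integral of its a.e. derivative) and its derivative is square integrable. -/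
def IsH1 (L : ℝ) (f : ℝ → F) : Prop :=
  MemLp (dx L f) 2 (volume.restrict (Icc 0 L)) ∧
    ∀ x ∈ Icc (0 : ℝ) L, f x = f 0 + ∫ t in (0 : ℝ)..x, dx L f t

/-- `f ∈ H²([0, L]; F)`: both `f` and `∂ₓ f` are of class `H¹`. -/
def IsH2 (L : ℝ) (f : ℝ → F) : Prop := IsH1 L f ∧ IsH1 L (dx L f)

end Sobolev

/-- The length `ℓ(Υ) = ∫₀ᴸ |∂ₓ Υ| dx` of a curve parametrized on `[0, L]`. -/
def length (L : ℝ) (Υ : ℝ → Plane) : ℝ := ∫ x in (0 : ℝ)..L, ‖dx L Υ x‖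

/-- `κ` is (a representative of) the signed curvature of the curve `Υ`, which is parametrized on
`[0, L]` with constant speed `ℓ(Υ) / L`: there is an `H¹` lifting `θ` of the unit tangent,
`∂ₓ Υ = (ℓ(Υ) / L) (cos θ, sin θ)`, and `κ = ∂ₛ θ = (L / ℓ(Υ)) ∂ₓ θ`, where `s` is arclength. -/
def IsSignedCurvature (L : ℝ) (Υ : ℝ → Plane) (κ : ℝ → ℝ) : Prop :=
  ∃ θ : ℝ → ℝ, IsH1 L θ ∧
    (∀ x ∈ Icc (0 : ℝ) L,
      dx L Υ x = (length L Υ / L) • (!₂[Real.cos (θ x), Real.sin (θ x)] : Plane)) ∧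
    ∀ᵐ x ∂(volume.restrict (Icc 0 L)), κ x = L / length L Υ * dx L θ x

/-- The class `X` of pairs `(Υ, κ_Υ)`: an `H²` curve `Υ`, parametrized on `[0, |p - q|]` with
constant speed, going from `p` to `q`, whose tangent vectors at both endpoints are horizontal and
point in the direction of `q - p`, together with its signed curvature. -/
structure IsAdmissible (p q : Plane) (Υ : ℝ → Plane) (κ : ℝ → ℝ) : Prop where
  isH2 : IsH2 (dist p q) Υ
  speed : ∀ x ∈ Icc 0 (dist p q), ‖dx (dist p q) Υ x‖ = length (dist p q) Υ / dist p q
  start_eq : Υ 0 = p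
  end_eq : Υ (dist p q) = q
  horizontal_start : dx (dist p q) Υ 0 1 = 0
  horizontal_end : dx (dist p q) Υ (dist p q) 1 = 0
  forward_start : 0 < inner ℝ (q - p) (dx (dist p q) Υ 0)
  forward_end : 0 < inner ℝ (q - p) (dx (dist p q) Υ (dist p q))
  curvature : IsSignedCurvature (dist p q) Υ κ

/-- The rescaled elastic energy
`G_ε(Υ) = ε^{1/2} ∫ κ² ds + ε^{-1/2} (ℓ(Υ) - |p - q|)`, where `ds = (ℓ(Υ) / |p - q|) dx`. -/
def energy (p q : Plane) (ε : ℝ) (Υ : ℝ → Plane) (κ : ℝ → ℝ) : ℝ :=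
  √ε * (length (dist p q) Υ / dist p q * ∫ x in (0 : ℝ)..dist p q, κ x ^ 2) +
    (√ε)⁻¹ * (length (dist p q) Υ - dist p q)

/-- The flat norm on `[0, L]`: the supremum of `∫ φ dμ` over all Lipschitz `φ : [0, L] → ℝ` with
`‖φ‖_∞ + Lip(φ) ≤ 1`. -/
def flatNorm {L : ℝ} (μ : SignedMeasure (Icc (0 : ℝ) L)) : ℝ≥0∞ :=
  ⨆ (φ : Icc (0 : ℝ) L → ℝ)
    (_ : ∃ A K : ℝ, 0 ≤ A ∧ 0 ≤ K ∧ A + K ≤ 1 ∧ (∀ x, |φ x| ≤ A) ∧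
      ∀ x y, |φ x - φ y| ≤ K * |(x : ℝ) - y|),
    ENNReal.ofReal (∫ᵛ x, φ x ∂•μ)

/-- The measure `κ dx` on `[0, L]`. -/
def densityMeasure (L : ℝ) (κ : ℝ → ℝ) : SignedMeasure (Icc (0 : ℝ) L) :=
  ((volume : Measure ℝ).comap Subtype.val).withDensityᵥ fun x => κ x

/-- The atomic measure `2π ∑ⱼ cⱼ δ_{xⱼ}` on `[0, L]`. -/
def atomicMeasure {L : ℝ} {N : ℕ} (x : Fin N → Icc (0 : ℝ) L) (c : Fin N → ℤ) :
    SignedMeasure (Icc (0 : ℝ) L) :=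
  ∑ j, VectorMeasure.dirac (x j) (2 * Real.pi * (c j : ℝ))

/-- Convergence of pairs (curve, measure) on `[0, L]` along a filter: the curves converge in
`H¹([0, L]; ℝ²)` and the measures converge in the flat norm. -/
def PairTendsto {ι : Type*} {L : ℝ} (Υ : ι → ℝ → Plane) (μ : ι → SignedMeasure (Icc (0 : ℝ) L))
    (l : Filter ι) (Υ₀ : ℝ → Plane) (μ₀ : SignedMeasure (Icc (0 : ℝ) L)) : Prop :=
  Tendsto (fun i => eLpNorm (fun x => Υ i x - Υ₀ x) 2 (volume.restrict (Icc 0 L))) l (𝓝 0) ∧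
  Tendsto (fun i => eLpNorm (fun x => dx L (Υ i) x - dx L Υ₀ x) 2 (volume.restrict (Icc 0 L)))
    l (𝓝 0) ∧
  Tendsto (fun i => flatNorm (μ i - μ₀)) l (𝓝 0)

/-- `(Υ, μ)` is a pointed segment with singularities `xⱼ` and multiplicities `cⱼ`: on
`[0, |p - q|]` the curve `Υ` is the segment `p + (x / |p - q|) (q - p)`, the points `xⱼ` are
increasing and `μ = 2π ∑ⱼ cⱼ δ_{xⱼ}`. -/
def IsPointedSegmentWith (p q : Plane) (Υ : ℝ → Plane) (μ : SignedMeasure (Icc (0 : ℝ) (dist p q)))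
    {N : ℕ} (x : Fin N → Icc (0 : ℝ) (dist p q)) (c : Fin N → ℤ) : Prop :=
  (∀ t ∈ Icc 0 (dist p q), Υ t = p + (t / dist p q) • (q - p)) ∧ StrictMono x ∧
    μ = atomicMeasure x c

/-- The set `Dom_G` of pointed segments. -/
def IsPointedSegment (p q : Plane) (Υ : ℝ → Plane)
    (μ : SignedMeasure (Icc (0 : ℝ) (dist p q))) : Prop :=
  ∃ (N : ℕ) (x : Fin N → Icc (0 : ℝ) (dist p q)) (c : Fin N → ℤ),
    IsPointedSegmentWith p q Υ μ x c

/-- The limit functional `G`: it is `∑ⱼ |cⱼ|` on pointed segments (independently of the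
representation, see `limitEnergy_eq`) and `+∞` on all other pairs (the infimum of the empty
set). -/
def limitEnergy (p q : Plane) (Υ : ℝ → Plane) (μ : SignedMeasure (Icc (0 : ℝ) (dist p q))) :
    EReal :=
  ⨅ (N : ℕ) (x : Fin N → Icc (0 : ℝ) (dist p q)) (c : Fin N → ℤ)
    (_ : IsPointedSegmentWith p q Υ μ x c), ((∑ j, |(c j : ℝ)| : ℝ) : EReal)

theorem atomicMeasure_singleton {L : ℝ} {N : ℕ} (x : Fin N → Icc (0 : ℝ) L) (c : Fin N → ℤ)
    (y : Icc (0 : ℝ) L) :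
    atomicMeasure x c {y} = ∑ j, if x j = y then 2 * Real.pi * (c j : ℝ) else 0 := by
  classical
  simp only [atomicMeasure, FunLike.coe_sum, Finset.sum_apply]
  refine Finset.sum_congr rfl fun j _ => ?_
  split_ifs with h
  · exact VectorMeasure.dirac_apply_of_mem (measurableSet_singleton y) h
  · exact VectorMeasure.dirac_apply_of_notMem h

theorem sum_abs_eq {L : ℝ} {N : ℕ} {x : Fin N → Icc (0 : ℝ) L} (hx : StrictMono x)
    (c : Fin N → ℤ) (S : Finset (Icc (0 : ℝ) L)) (hS : ∀ j, x j ∈ S) :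
    2 * Real.pi * ∑ j, |(c j : ℝ)| = ∑ y ∈ S, |atomicMeasure x c {y}| := by
  classical
  have h1 : ∀ j, |atomicMeasure x c {x j}| = 2 * Real.pi * |(c j : ℝ)| := fun j => by
    rw [atomicMeasure_singleton, Finset.sum_eq_single j]
    · simp [abs_mul, abs_of_pos Real.pi_pos]
    · intro i _ hi
      rw [if_neg fun h => hi (hx.injective h)]
    · simp
  rw [Finset.mul_sum]
  simp_rw [← h1]
  rw [← Finset.sum_image (s := Finset.univ) (g := x) (f := fun y => |atomicMeasure x c {y}|)
    fun i _ j _ h => hx.injective h]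
  refine Finset.sum_subset (fun y hy => ?_) fun y _ hy => ?_
  · obtain ⟨j, -, rfl⟩ := Finset.mem_image.1 hy
    exact hS j
  · rw [atomicMeasure_singleton, Finset.sum_eq_zero, abs_zero]
    intro j _
    rw [if_neg]
    rintro rfl
    exact hy (Finset.mem_image_of_mem _ (Finset.mem_univ j))

theorem limitEnergy_eq {p q : Plane} {Υ : ℝ → Plane}
    {μ : SignedMeasure (Icc (0 : ℝ) (dist p q))} {N : ℕ}
    {x : Fin N → Icc (0 : ℝ) (dist p q)} {c : Fin N → ℤ}
    (h : IsPointedSegmentWith p q Υ μ x c) :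
    limitEnergy p q Υ μ = ((∑ j, |(c j : ℝ)| : ℝ) : EReal) := by
  classical
  refine le_antisymm (iInf₂_le_of_le N x (iInf₂_le c h)) ?_
  refine le_iInf₂ fun N' x' => le_iInf₂ fun c' h' => le_of_eq ?_
  have e1 := sum_abs_eq h.2.1 c (Finset.univ.image x ∪ Finset.univ.image x') (by simp)
  have e2 := sum_abs_eq h'.2.1 c' (Finset.univ.image x ∪ Finset.univ.image x') (by simp)
  rw [← h.2.2] at e1
  rw [← h'.2.2, ← e1] at e2
  rw [mul_left_cancel₀ (by positivity) e2]

end PointedCurve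

end

/-!
The proof is an argument of Modica–Mortola type for the angle `ψ` between the tangent of an
admissible curve and the direction of `q - p`. With the length `ℓ` and `L = |p - q|`, the end point
condition reads `ℓ ∫ cos ψ = L²`, so that the excess length is `(ℓ / L) ∫ (1 - cos ψ)`
(`IsAngle.length_sub_dist`), and the energy is an integral of the form
`∫ (r ψ'² + r⁻¹ (1 - cos ψ))` with `r = ε^{1/2} L / ℓ`. The potential `1 - cos ψ = 2 sin² (ψ / 2)`
vanishes at the multiples of `2π`, and Young's inequality bounds the energy from below by
`2√2 ∫ |ψ'| |sin (ψ / 2)|`, the variation of `angleCost ∘ ψ` (`IsAngle.variation_le_energy`); a full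
turn costs `8√2`.

*Compactness and lower bound.* The excess length is `O(ε^{1/2})`, so the curves converge to the
segment (`tendsto_curves`). For the curvature, `ψ' dx` is integrated by parts against a Lipschitz
function `φ`, on a partition of `[0, L]` into a bounded number of intervals on which
`angleCost ∘ ψ` has variation at most `1`. On each of them `ψ` stays close to a single multiple of
`2π`, at a distance whose integral is controlled by `∫ (1 - cos ψ)`. So the curvature is close in
the flat norm to the jumps between these multiples, a bounded number of atoms `± 2π`. Up to a small
error, the same computation for `angleCost ∘ ψ` bounds `8√2 ∑ cⱼ φ(xⱼ)` by the energy when `|φ| ≤ 1`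
(`exists_atoms`, `exists_atoms_of_isAdmissible`). The positions of the atoms lie in a compact
interval, which gives the compactness and `8√2 ∑ |cⱼ| ≤ C` at once (`exists_subseq_tendsto`). If the
lower bound failed, this would apply to a subsequence with energies below the claimed bound, and
limits in the flat norm are unique (`flatLimit_unique`).

*Recovery.* Near `xⱼ` the angle makes `cⱼ` turns with `s |ψ'| = √(1 - cos ψ + η²)`. For `η = 0` this
is the equality case of Young's inequality, which never completes a turn; with `η > 0` a turn takes
finite time (`exists_profile`, `exists_isTransition`). Since `sin ψ` is a multiple of the derivative
of `|ψ'|`, which is the same before and after the turns, `∫ sin ψ = 0` and the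
curve ends on the `x`-axis; the length is chosen afterwards so that it ends at `q`
(`exists_recovery_angle`, `exists_isAdmissible`). The convergence of the energies combines the
upper bound by construction with the lower bound already proved (`exists_recovery`).
-/

namespace PointedCurve

/-! ### Testing signed measures against bounded Lipschitz functions -/

/-- A bounded Lipschitz function on `[0, L]`, with its sup bound `A` and its Lipschitz
constant `K`. The flat norm is a supremum over the `φ` with `IsTest A K φ` and `A + K ≤ 1`. -/
structure IsTest {L : ℝ} (A K : ℝ) (φ : Icc (0 : ℝ) L → ℝ) : Prop where
  nonneg_bound : 0 ≤ A
  nonneg_lip : 0 ≤ K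
  bound : ∀ x, |φ x| ≤ A
  lip : ∀ x y, |φ x - φ y| ≤ K * |(x : ℝ) - y|

namespace IsTest

variable {L A K : ℝ} {φ : Icc (0 : ℝ) L → ℝ}

theorem lipschitzWith (h : IsTest A K φ) : LipschitzWith K.toNNReal φ :=
  LipschitzWith.of_dist_le_mul fun x y => by
    rw [Real.coe_toNNReal _ h.nonneg_lip]
    exact h.lip x y

theorem measurable (h : IsTest A K φ) : Measurable φ := h.lipschitzWith.continuous.measurable

theorem const_mul (h : IsTest A K φ) (r : ℝ) : IsTest (|r| * A) (|r| * K) fun x => r * φ x where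
  nonneg_bound := mul_nonneg (abs_nonneg r) h.nonneg_bound
  nonneg_lip := mul_nonneg (abs_nonneg r) h.nonneg_lip
  bound x := by
    rw [abs_mul]
    exact mul_le_mul_of_nonneg_left (h.bound x) (abs_nonneg r)
  lip x y := by
    rw [← mul_sub, abs_mul, mul_assoc]
    exact mul_le_mul_of_nonneg_left (h.lip x y) (abs_nonneg r)

end IsTest

theorem isFiniteMeasure_variation {α : Type*} [MeasurableSpace α] (μ : SignedMeasure α) :
    IsFiniteMeasure μ.variation := by
  have h : μ.variation ≤ μ.toJordanDecomposition.posPart + μ.toJordanDecomposition.negPart := by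
    conv_lhs => rw [← μ.toSignedMeasure_toJordanDecomposition]
    refine VectorMeasure.variation_sub_le.trans ?_
    rw [Measure.variation_toSignedMeasure, Measure.variation_toSignedMeasure]
  exact isFiniteMeasure_of_le _ h

theorem IsTest.integrable {L A K : ℝ} {φ : Icc (0 : ℝ) L → ℝ} (h : IsTest A K φ)
    (μ : SignedMeasure (Icc (0 : ℝ) L)) : μ.Integrable φ := by
  have := isFiniteMeasure_variation μ
  exact Integrable.of_bound h.measurable.aestronglyMeasurable A (Eventually.of_forall h.bound)

/-- For real-valued densities the two scalar pairings of Mathlib coincide. -/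
theorem lsmul_flip_eq :
    (ContinuousLinearMap.lsmul ℝ ℝ : ℝ →L[ℝ] ℝ →L[ℝ] ℝ).flip = ContinuousLinearMap.lsmul ℝ ℝ := by
  ext
  simp

theorem integral_toSignedMeasure_eq {α : Type*} [MeasurableSpace α] (μ : Measure α)
    [IsFiniteMeasure μ] (f : α → ℝ) : ∫ᵛ x, f x ∂•μ.toSignedMeasure = ∫ x, f x ∂μ := by
  rw [← VectorMeasure.integral_toSignedMeasure, lsmul_flip_eq]

theorem integral_toJordan {L A K : ℝ} {φ : Icc (0 : ℝ) L → ℝ} (h : IsTest A K φ)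
    (μ : SignedMeasure (Icc (0 : ℝ) L)) :
    ∫ᵛ x, φ x ∂•μ = ∫ x, φ x ∂μ.toJordanDecomposition.posPart -
      ∫ x, φ x ∂μ.toJordanDecomposition.negPart := by
  conv_lhs => rw [← μ.toSignedMeasure_toJordanDecomposition]
  rw [JordanDecomposition.toSignedMeasure, VectorMeasure.integral_sub_vectorMeasure
    (h.integrable _) (h.integrable _), integral_toSignedMeasure_eq, integral_toSignedMeasure_eq]

theorem integral_withDensityᵥ_eq {α : Type*} [MeasurableSpace α] {ν : Measure α}
    {f φ : α → ℝ} (hf : Integrable f ν) (hφ : Measurable φ) {A : ℝ} (hA : ∀ x, |φ x| ≤ A) :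
    ∫ᵛ x, φ x ∂•(ν.withDensityᵥ f) = ∫ x, φ x * f x ∂ν := by
  have fin1 := isFiniteMeasure_withDensity_ofReal hf.2
  have fin2 := isFiniteMeasure_withDensity_ofReal hf.neg.2
  have hb : ∀ μ : SignedMeasure α, μ.Integrable φ := fun μ => by
    have := isFiniteMeasure_variation μ
    exact Integrable.of_bound hφ.aestronglyMeasurable A (Eventually.of_forall hA)
  rw [withDensityᵥ_eq_withDensity_pos_part_sub_withDensity_neg_part hf,
    VectorMeasure.integral_sub_vectorMeasure (hb _) (hb _)]
  have e : ∀ g : α → ℝ, Integrable g ν → ∀ [IsFiniteMeasure (ν.withDensity fun x =>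
      ENNReal.ofReal (g x))], ∫ᵛ x, φ x ∂•(ν.withDensity fun x =>
      ENNReal.ofReal (g x)).toSignedMeasure = ∫ x, φ x * max (g x) 0 ∂ν := fun g hg _ => by
    rw [integral_toSignedMeasure_eq, integral_withDensity_eq_integral_toReal_smul₀
      hg.1.aemeasurable.ennreal_ofReal (Eventually.of_forall fun x => ENNReal.ofReal_lt_top)]
    refine integral_congr_ae (Eventually.of_forall fun x => ?_)
    simp only [smul_eq_mul, ENNReal.toReal_ofReal', mul_comm]
  have fin2' : IsFiniteMeasure (ν.withDensity fun x => ENNReal.ofReal (-f x)) := fin2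
  rw [e f hf, e (fun x => -f x) hf.neg, ← integral_sub]
  · refine integral_congr_ae (Eventually.of_forall fun x => ?_)
    simp only
    rw [← mul_sub]
    congr 1
    rcases le_total (f x) 0 with h | h
    · rw [max_eq_right h, max_eq_left (by linarith)]; ring
    · rw [max_eq_left h, max_eq_right (by linarith)]; ring
  · exact hf.pos_part.bdd_mul hφ.aestronglyMeasurable (Eventually.of_forall hA)
  · exact hf.neg.pos_part.bdd_mul hφ.aestronglyMeasurable (Eventually.of_forall hA)

theorem integral_atomicMeasure {L A K : ℝ} {φ : Icc (0 : ℝ) L → ℝ} (h : IsTest A K φ) {N : ℕ}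
    (x : Fin N → Icc (0 : ℝ) L) (c : Fin N → ℤ) :
    ∫ᵛ y, φ y ∂•(atomicMeasure x c) = 2 * Real.pi * ∑ j, (c j : ℝ) * φ (x j) := by
  rw [atomicMeasure, VectorMeasure.integral_finsetSum_vectorMeasure fun j _ => h.integrable _,
    Finset.mul_sum]
  refine Finset.sum_congr rfl fun j _ => ?_
  rw [VectorMeasure.integral_dirac]
  simp
  ring

/-- The extension of a function on `[0, L]` which is constant on both sides. -/
theorem IsTest.lipschitzWith_extend {L A K : ℝ} (hL : 0 ≤ L) {φ : Icc (0 : ℝ) L → ℝ}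
    (h : IsTest A K φ) : LipschitzWith K.toNNReal (IccExtend hL φ) := by
  have := h.lipschitzWith.comp (LipschitzWith.projIcc hL)
  rwa [mul_one] at this

theorem IsTest.abs_extend_le {L A K : ℝ} (hL : 0 ≤ L) {φ : Icc (0 : ℝ) L → ℝ}
    (h : IsTest A K φ) (x : ℝ) : |IccExtend hL φ x| ≤ A := h.bound _

theorem integral_densityMeasure {L A K : ℝ} (hL : 0 ≤ L) {φ : Icc (0 : ℝ) L → ℝ}
    (h : IsTest A K φ) {κ : ℝ → ℝ} (hκ : IntegrableOn κ (Icc 0 L)) :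
    ∫ᵛ y, φ y ∂•(densityMeasure L κ) = ∫ x in (0 : ℝ)..L, IccExtend hL φ x * κ x := by
  have hκ' : Integrable (fun x : Icc (0 : ℝ) L => κ x) ((volume : Measure ℝ).comap Subtype.val) :=
    (MeasurableEmbedding.subtype_coe measurableSet_Icc).integrable_map_iff.1 (by
      rwa [map_comap_subtype_coe measurableSet_Icc])
  rw [densityMeasure, integral_withDensityᵥ_eq hκ' h.measurable h.bound,
    intervalIntegral.integral_of_le hL, ← integral_Icc_eq_integral_Ioc,
    ← integral_subtype_comap measurableSet_Icc]
  refine integral_congr_ae (Eventually.of_forall fun x => ?_)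
  simp only [IccExtend_val]

/-- Bounded Lipschitz functions separate finite measures: the thickened indicators of a closed
set are Lipschitz and decrease to its indicator. -/
theorem measure_ext_of_isTest {L : ℝ} {μ ν : Measure (Icc (0 : ℝ) L)} [IsFiniteMeasure μ]
    [IsFiniteMeasure ν] (h : ∀ (A K : ℝ) (φ : Icc (0 : ℝ) L → ℝ), IsTest A K φ →
      ∫ x, φ x ∂μ = ∫ x, φ x ∂ν) : μ = ν := by
  have key : ∀ F : Set (Icc (0 : ℝ) L), IsClosed F → μ F = ν F := fun F hF => by
    have hδ : ∀ n : ℕ, (0 : ℝ) < 1 / ((n : ℝ) + 1) := fun n => by positivity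
    have l1 := tendsto_lintegral_thickenedIndicator_of_isClosed μ hF hδ
      tendsto_one_div_add_atTop_nhds_zero_nat
    have l2 := tendsto_lintegral_thickenedIndicator_of_isClosed ν hF hδ
      tendsto_one_div_add_atTop_nhds_zero_nat
    refine tendsto_nhds_unique l1 (l2.congr fun n => ?_)
    set f := thickenedIndicator (hδ n) F
    have hf : IsTest 1 ((1 / ((n : ℝ) + 1)).toNNReal⁻¹ : NNReal) fun x => ((f x : NNReal) : ℝ) :=
      { nonneg_bound := zero_le_one
        nonneg_lip := NNReal.coe_nonneg _
        bound := fun x => by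
          rw [abs_of_nonneg (NNReal.coe_nonneg _)]
          exact NNReal.coe_le_one.2 (thickenedIndicator_le_one (hδ n) F x)
        lip := fun x y => (lipschitzWith_thickenedIndicator (hδ n) F).dist_le_mul x y }
    have e := h _ _ _ hf
    have e' : ∀ (ρ : Measure (Icc (0 : ℝ) L)) [IsFiniteMeasure ρ],
        ∫⁻ x, (f x : ℝ≥0∞) ∂ρ = ENNReal.ofReal (∫ x, ((f x : NNReal) : ℝ) ∂ρ) := fun ρ _ => by
      rw [ofReal_integral_eq_lintegral_ofReal
        (Integrable.of_bound hf.measurable.aestronglyMeasurable 1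
          (Eventually.of_forall hf.bound))
        (Eventually.of_forall fun x => NNReal.coe_nonneg _)]
      simp
    rw [e', e', e]
  exact ext_of_generate_finite {F | IsClosed F}
    (by rw [← borel_eq_generateFrom_isClosed]; exact BorelSpace.measurable_eq)
    isPiSystem_isClosed (fun F hF => key F hF) (key univ isClosed_univ)

theorem signedMeasure_ext_of_isTest {L : ℝ} {μ ν : SignedMeasure (Icc (0 : ℝ) L)}
    (h : ∀ (A K : ℝ) (φ : Icc (0 : ℝ) L → ℝ), IsTest A K φ →
      ∫ᵛ x, φ x ∂•μ = ∫ᵛ x, φ x ∂•ν) : μ = ν := by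
  have e : μ.toJordanDecomposition.posPart + ν.toJordanDecomposition.negPart =
      ν.toJordanDecomposition.posPart + μ.toJordanDecomposition.negPart := by
    refine measure_ext_of_isTest fun A K φ hφ => ?_
    have hi : ∀ (ρ : Measure (Icc (0 : ℝ) L)) [IsFiniteMeasure ρ], Integrable φ ρ := fun ρ _ =>
      Integrable.of_bound hφ.measurable.aestronglyMeasurable A (Eventually.of_forall hφ.bound)
    rw [integral_add_measure (hi _) (hi _), integral_add_measure (hi _) (hi _)]
    have := h A K φ hφ
    rw [integral_toJordan hφ, integral_toJordan hφ] at this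
    linarith
  rw [← μ.toSignedMeasure_toJordanDecomposition, ← ν.toSignedMeasure_toJordanDecomposition,
    JordanDecomposition.toSignedMeasure, JordanDecomposition.toSignedMeasure,
    sub_eq_sub_iff_add_eq_add, ← Measure.toSignedMeasure_add, ← Measure.toSignedMeasure_add]
  simp only [e]

theorem le_flatNorm {L A K : ℝ} {φ : Icc (0 : ℝ) L → ℝ} (h : IsTest A K φ) (hAK : A + K ≤ 1)
    (μ : SignedMeasure (Icc (0 : ℝ) L)) : ENNReal.ofReal (∫ᵛ x, φ x ∂•μ) ≤ flatNorm μ :=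
  le_iSup₂_of_le φ ⟨A, K, h.nonneg_bound, h.nonneg_lip, hAK, h.bound, h.lip⟩ le_rfl

theorem flatNorm_le {L δ : ℝ} {μ : SignedMeasure (Icc (0 : ℝ) L)}
    (h : ∀ (A K : ℝ) (φ : Icc (0 : ℝ) L → ℝ), IsTest A K φ → A + K ≤ 1 → ∫ᵛ x, φ x ∂•μ ≤ δ) :
    flatNorm μ ≤ ENNReal.ofReal δ :=
  iSup₂_le fun φ ⟨A, K, hA, hK, hAK, hb, hl⟩ =>
    ENNReal.ofReal_le_ofReal (h A K φ ⟨hA, hK, hb, hl⟩ hAK)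

/-- A uniform bound of the errors over all test functions gives convergence in the flat norm. -/
theorem tendsto_flatNorm_of_le {ι : Type*} {l : Filter ι} {L : ℝ}
    {ν : ι → SignedMeasure (Icc (0 : ℝ) L)} {μ : SignedMeasure (Icc (0 : ℝ) L)} {δ : ι → ℝ}
    (hδ : Tendsto δ l (𝓝 0))
    (h : ∀ᶠ i in l, ∀ (A K : ℝ) (φ : Icc (0 : ℝ) L → ℝ), IsTest A K φ → A + K ≤ 1 →
      ∫ᵛ x, φ x ∂•(ν i) - ∫ᵛ x, φ x ∂•μ ≤ δ i) :
    Tendsto (fun i => flatNorm (ν i - μ)) l (𝓝 0) := by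
  have h0 : Tendsto (fun i => ENNReal.ofReal (δ i)) l (𝓝 0) := by
    simpa only [ENNReal.ofReal_zero] using! (ENNReal.continuous_ofReal.tendsto 0).comp hδ
  refine tendsto_of_tendsto_of_tendsto_of_le_of_le' tendsto_const_nhds h0
    (Eventually.of_forall fun i => zero_le) (h.mono fun i hi => flatNorm_le fun A K φ hφ hAK => ?_)
  rw [VectorMeasure.integral_sub_vectorMeasure (hφ.integrable _) (hφ.integrable _)]
  exact hi A K φ hφ hAK

theorem tendsto_integral_of_flatNorm {ι : Type*} {l : Filter ι} {L A K : ℝ}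
    {ν : ι → SignedMeasure (Icc (0 : ℝ) L)} {μ : SignedMeasure (Icc (0 : ℝ) L)}
    (h : Tendsto (fun i => flatNorm (ν i - μ)) l (𝓝 0)) {φ : Icc (0 : ℝ) L → ℝ}
    (hφ : IsTest A K φ) :
    Tendsto (fun i => ∫ᵛ x, φ x ∂•(ν i)) l (𝓝 (∫ᵛ x, φ x ∂•μ)) := by
  set R := A + K + 1 with hR
  have hR0 : 0 < R := by have := hφ.nonneg_bound; have := hφ.nonneg_lip; linarith
  have hr : Tendsto (fun i => R * (flatNorm (ν i - μ)).toReal) l (𝓝 0) := by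
    simpa using ((ENNReal.tendsto_toReal ENNReal.zero_ne_top).comp h).const_mul R
  have hfin : ∀ᶠ i in l, flatNorm (ν i - μ) < ⊤ := h.eventually_lt_const ENNReal.zero_lt_top
  rw [tendsto_iff_dist_tendsto_zero]
  refine tendsto_of_tendsto_of_tendsto_of_le_of_le' tendsto_const_nhds hr
    (Eventually.of_forall fun i => dist_nonneg) (hfin.mono fun i hi => ?_)
  have one : ∀ s : ℝ, |s| = 1 → s * (∫ᵛ x, φ x ∂•(ν i - μ)) ≤
      R * (flatNorm (ν i - μ)).toReal := fun s hs => by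
    have ht := hφ.const_mul (s * R⁻¹)
    have hle := le_flatNorm ht (by
      rw [abs_mul, hs, abs_of_pos (inv_pos.2 hR0), ← mul_add, one_mul, inv_mul_le_iff₀ hR0]
      linarith) (ν i - μ)
    have e : ∫ᵛ x, s * R⁻¹ * φ x ∂•(ν i - μ) = s * R⁻¹ * ∫ᵛ x, φ x ∂•(ν i - μ) :=
      VectorMeasure.integral_fun_smul _ _ (s * R⁻¹) φ
    rw [e, ENNReal.ofReal_le_iff_le_toReal hi.ne] at hle
    calc s * (∫ᵛ x, φ x ∂•(ν i - μ)) = R * (s * R⁻¹ * ∫ᵛ x, φ x ∂•(ν i - μ)) := by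
          field_simp
      _ ≤ _ := mul_le_mul_of_nonneg_left hle hR0.le
  rw [Real.dist_eq, ← VectorMeasure.integral_sub_vectorMeasure (hφ.integrable _)
    (hφ.integrable _)]
  refine abs_le'.2 ⟨?_, ?_⟩
  · simpa using one 1 (by simp)
  · simpa using one (-1) (by simp)

theorem flatLimit_unique {ι : Type*} {l : Filter ι} [l.NeBot] {L : ℝ}
    {ν : ι → SignedMeasure (Icc (0 : ℝ) L)} {μ μ' : SignedMeasure (Icc (0 : ℝ) L)}
    (h : Tendsto (fun i => flatNorm (ν i - μ)) l (𝓝 0))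
    (h' : Tendsto (fun i => flatNorm (ν i - μ')) l (𝓝 0)) : μ = μ' :=
  signedMeasure_ext_of_isTest fun _ _ _ hφ =>
    tendsto_nhds_unique (tendsto_integral_of_flatNorm h hφ) (tendsto_integral_of_flatNorm h' hφ)

/-! ### The primitive of `|sin (t / 2)|` -/

/-- The primitive of `|sin (t / 2)|` which vanishes at `0`. Composed with the tangent angle, it
measures how much energy a change of the angle costs. -/
noncomputable def angleCost (t : ℝ) : ℝ := ∫ s in (0 : ℝ)..t, |Real.sin (s / 2)|

theorem continuous_abs_sin_half : Continuous fun s : ℝ => |Real.sin (s / 2)| := by fun_prop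

theorem hasDerivAt_angleCost (t : ℝ) : HasDerivAt angleCost |Real.sin (t / 2)| t :=
  intervalIntegral.integral_hasDerivAt_right (continuous_abs_sin_half.intervalIntegrable _ _)
    (continuous_abs_sin_half.stronglyMeasurableAtFilter _ _) continuous_abs_sin_half.continuousAt

theorem lipschitzWith_angleCost : LipschitzWith 1 angleCost :=
  lipschitzWith_of_nnnorm_deriv_le (fun t => (hasDerivAt_angleCost t).differentiableAt) fun t => by
    rw [(hasDerivAt_angleCost t).deriv, ← NNReal.coe_le_coe]
    simpa using Real.abs_sin_le_one (t / 2)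

theorem monotone_angleCost : Monotone angleCost :=
  monotone_of_deriv_nonneg (fun t => (hasDerivAt_angleCost t).differentiableAt) fun t => by
    rw [(hasDerivAt_angleCost t).deriv]
    exact abs_nonneg _

theorem angleCost_neg (t : ℝ) : angleCost (-t) = -angleCost t := by
  have h := intervalIntegral.integral_comp_neg (a := 0) (b := t) fun s => |Real.sin (s / 2)|
  simp only [neg_div, Real.sin_neg, abs_neg, neg_zero] at h
  rw [angleCost, intervalIntegral.integral_symm, ← h, angleCost]

theorem angleCost_eq {t : ℝ} (h0 : 0 ≤ t) (h1 : t ≤ 2 * Real.pi) :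
    angleCost t = 2 - 2 * Real.cos (t / 2) := by
  have e : ∫ s in (0 : ℝ)..t, |Real.sin (s / 2)| = ∫ s in (0 : ℝ)..t, Real.sin (s / 2) := by
    refine intervalIntegral.integral_congr fun s hs => abs_of_nonneg ?_
    rw [uIcc_of_le h0] at hs
    exact Real.sin_nonneg_of_nonneg_of_le_pi (by linarith [hs.1]) (by linarith [hs.2])
  rw [angleCost, e, intervalIntegral.integral_eq_sub_of_hasDerivAt
    (f := fun s => -2 * Real.cos (s / 2))]
  · simp
    ring
  · intro s _
    have := ((hasDerivAt_id s).div_const 2).cos.const_mul (-2)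
    refine this.congr_deriv ?_
    simp only [id_eq]
    ring
  · exact (by fun_prop : Continuous fun s : ℝ => Real.sin (s / 2)).intervalIntegrable _ _

theorem periodic_abs_sin_half :
    Function.Periodic (fun s : ℝ => |Real.sin (s / 2)|) (2 * Real.pi) := fun s => by
  simp only
  rw [show (s + 2 * Real.pi) / 2 = s / 2 + Real.pi by ring, Real.sin_add_pi, abs_neg]

theorem angleCost_add_int (t : ℝ) (k : ℤ) :
    angleCost (t + 2 * Real.pi * k) = angleCost t + 4 * k := by
  have hi : ∀ a b : ℝ, IntervalIntegrable (fun s : ℝ => |Real.sin (s / 2)|) volume a b :=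
    fun a b => continuous_abs_sin_half.intervalIntegrable a b
  have h := periodic_abs_sin_half.intervalIntegral_add_zsmul_eq k t hi
  rw [periodic_abs_sin_half.intervalIntegral_add_eq t 0, zero_add] at h
  have h4 : ∫ s in (0 : ℝ)..2 * Real.pi, |Real.sin (s / 2)| = 4 := by
    have := angleCost_eq (t := 2 * Real.pi) (by positivity) le_rfl
    rw [show 2 * Real.pi / 2 = Real.pi by ring, Real.cos_pi] at this
    rw [← angleCost, this]
    norm_num
  rw [h4, zsmul_eq_mul, zsmul_eq_mul, mul_comm (k : ℝ) (2 * Real.pi)] at h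
  rw [angleCost, ← intervalIntegral.integral_add_adjacent_intervals (hi 0 t) (hi t _), h,
    angleCost]
  ring

theorem angleCost_zero : angleCost 0 = 0 := intervalIntegral.integral_same

theorem angleCost_int (k : ℤ) : angleCost (2 * Real.pi * k) = 4 * k := by
  simpa [angleCost_zero] using angleCost_add_int 0 k

/-- An angle which starts in `[-π, π]` has to pay more than `1` to leave `[-3π/2, 3π/2]`. -/
theorem abs_le_of_angleCost {s t : ℝ} (ht : |t| ≤ Real.pi)
    (h : |angleCost s - angleCost t| ≤ 1) : |s| ≤ 3 * Real.pi / 2 := by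
  have key : ∀ s t : ℝ, t ≤ Real.pi → angleCost s - angleCost t ≤ 1 → s ≤ 3 * Real.pi / 2 := by
    intro s t ht h
    by_contra! hs
    have hpi := Real.pi_pos
    have h1 := monotone_angleCost hs.le
    have h2 := monotone_angleCost ht
    rw [angleCost_eq (by positivity) (by linarith), show 3 * Real.pi / 2 / 2 =
      Real.pi - Real.pi / 4 by ring, Real.cos_pi_sub, Real.cos_pi_div_four] at h1
    rw [angleCost_eq hpi.le (by linarith), Real.cos_pi_div_two] at h2
    have : (1 : ℝ) < √2 := Real.lt_sqrt_of_sq_lt (by norm_num)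
    linarith
  rw [abs_le] at ht h ⊢
  have h1 := key s t ht.2 h.2
  have h2 := key (-s) (-t) (by linarith) (by rw [angleCost_neg, angleCost_neg]; linarith)
  exact ⟨by linarith, h1⟩

theorem sq_le_one_sub_cos {t : ℝ} (ht : |t| ≤ 3 * Real.pi / 2) :
    t ^ 2 ≤ 9 * Real.pi ^ 2 / 4 * (1 - Real.cos t) := by
  have hpi := Real.pi_pos
  rcases le_total |t| Real.pi with h | h
  · have h2 : 2 / Real.pi ^ 2 * t ^ 2 ≤ 1 - Real.cos t := by
      linarith [Real.cos_le_one_sub_mul_cos_sq h]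
    have h3 : t ^ 2 ≤ Real.pi ^ 2 / 2 * (1 - Real.cos t) := by
      calc t ^ 2 = Real.pi ^ 2 / 2 * (2 / Real.pi ^ 2 * t ^ 2) := by field_simp
        _ ≤ _ := mul_le_mul_of_nonneg_left h2 (by positivity)
    have h4 : 0 ≤ Real.pi ^ 2 * (1 - Real.cos t) :=
      mul_nonneg (by positivity) (by linarith [Real.cos_le_one t])
    linarith
  · have h1 : Real.cos t ≤ 0 := by
      rw [← Real.cos_abs]
      exact Real.cos_nonpos_of_pi_div_two_le_of_le (by linarith) (by linarith)
    have h2 : t ^ 2 ≤ (3 * Real.pi / 2) ^ 2 := by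
      rw [← sq_abs t]
      gcongr
    nlinarith [sq_nonneg Real.pi]

/-! ### Integration by parts against step functions -/

/-- Integration by parts against a Lipschitz function, where the remaining integral is bounded. -/
theorem abs_integral_mul_deriv_sub_le {φ g : ℝ → ℝ} {K : NNReal} {a b : ℝ} (hab : a ≤ b)
    (hφ : LipschitzWith K φ) (hg : AbsolutelyContinuousOnInterval g a b) (m : ℝ) :
    |(∫ x in a..b, φ x * deriv g x) - (φ b * (g b - m) - φ a * (g a - m))| ≤
      K * ∫ x in a..b, |g x - m| := by
  have hm : AbsolutelyContinuousOnInterval (fun x => g x - m) a b :=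
    hg.sub (LipschitzWith.const m).lipschitzOnWith.absolutelyContinuousOnInterval
  have h := hφ.lipschitzOnWith.absolutelyContinuousOnInterval.integral_mul_deriv_eq_deriv_mul
    (a := a) (b := b) hm
  simp only [deriv_sub_const_fun] at h
  rw [h, sub_sub_cancel_left, abs_neg, ← intervalIntegral.integral_const_mul]
  refine (intervalIntegral.abs_integral_le_integral_abs hab).trans
    (intervalIntegral.integral_mono_on hab ?_ ?_ fun x _ => ?_)
  · have hφ' := hφ.lipschitzOnWith.absolutelyContinuousOnInterval (a := a) (b := b)
    exact (hφ'.intervalIntegrable_deriv.mul_continuousOn hm.continuousOn).abs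
  · exact (hm.continuousOn.abs.intervalIntegrable).const_mul _
  · rw [abs_mul]
    exact mul_le_mul_of_nonneg_right (norm_deriv_le_of_lipschitz hφ) (abs_nonneg _)

/-- The derivative of a function which is close to the constant `m j` on the `j`-th interval of a
partition is close to the sum of the jumps `m (j + 1) - m j` at the interior points. -/
theorem abs_integral_sub_jumps_le {φ g : ℝ → ℝ} {K : NNReal} {L : ℝ} (hL : 0 ≤ L)
    (hφ : LipschitzWith K φ) (hg : AbsolutelyContinuousOnInterval g 0 L) {x : ℕ → ℝ} {n : ℕ}
    (hx : Monotone x) (h0 : x 0 = 0) (hn : x (n + 1) = L) {m : ℕ → ℝ} (hg0 : g 0 = m 0)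
    (hgL : g L = m n) :
    |(∫ t in (0 : ℝ)..L, φ t * deriv g t) -
        ∑ j ∈ Finset.range n, (m (j + 1) - m j) * φ (x (j + 1))| ≤
      K * ∑ j ∈ Finset.range (n + 1), ∫ t in x j..x (j + 1), |g t - m j| := by
  have hsub : ∀ j < n + 1, uIcc (x j) (x (j + 1)) ⊆ uIcc 0 L := fun j hj => by
    rw [uIcc_of_le (hx (Nat.le_succ j)), uIcc_of_le hL, ← hn, ← h0]
    exact Icc_subset_Icc (hx (Nat.zero_le j)) (hx hj)
  have hint : ∀ j < n + 1, IntervalIntegrable (fun t => φ t * deriv g t) volume (x j)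
      (x (j + 1)) := fun j hj =>
    (hg.mono (hsub j hj)).intervalIntegrable_deriv.continuousOn_mul
      hφ.continuous.continuousOn
  have hsum := intervalIntegral.sum_integral_adjacent_intervals hint
  rw [h0, hn] at hsum
  have tele : ∀ k : ℕ, ∑ j ∈ Finset.range (k + 1), (φ (x (j + 1)) * (g (x (j + 1)) - m j) -
      φ (x j) * (g (x j) - m j)) = φ (x (k + 1)) * (g (x (k + 1)) - m k) -
      φ (x 0) * (g (x 0) - m 0) + ∑ j ∈ Finset.range k, (m (j + 1) - m j) * φ (x (j + 1)) := by
    intro k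
    induction k with
    | zero => simp
    | succ k ih =>
      rw [Finset.sum_range_succ, ih, Finset.sum_range_succ _ k]
      ring
  have ht := tele n
  rw [hn, h0, hgL, hg0, sub_self, sub_self, mul_zero, mul_zero, sub_self, zero_add] at ht
  rw [← hsum, ← ht, ← Finset.sum_sub_distrib, Finset.mul_sum]
  refine (Finset.abs_sum_le_sum_abs _ _).trans (Finset.sum_le_sum fun j hj => ?_)
  exact abs_integral_mul_deriv_sub_le (hx (Nat.le_succ j)) hφ
    (hg.mono (hsub j (Finset.mem_range.1 hj))) (m j)

/-- A partition of `[0, L]` into `n` intervals on which `f ≥ 0` has small integral. -/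
theorem exists_partition {L : ℝ} (hL : 0 < L) {f : ℝ → ℝ} (hf : IntervalIntegrable f volume 0 L)
    (hf0 : ∀ x, 0 ≤ f x) {n : ℕ} (hn : 0 < n) :
    ∃ x : ℕ → ℝ, Monotone x ∧ x 0 = 0 ∧ x n = L ∧ (∀ j, x j ∈ Icc 0 L) ∧
      ∀ j, ∫ t in x j..x (j + 1), f t ≤ ((∫ t in (0 : ℝ)..L, f t) + L) / n := by
  -- The summand `1` makes the primitive `Q` strictly increasing.
  set Q : ℝ → ℝ := fun y => (∫ t in (0 : ℝ)..y, f t) + y with hQ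
  have hfi : ∀ a ∈ Icc 0 L, ∀ b ∈ Icc 0 L, IntervalIntegrable f volume a b := fun a ha b hb =>
    hf.mono_set (by
      rw [uIcc_of_le hL.le]
      exact uIcc_subset_Icc ha hb)
  have h0L : (0 : ℝ) ∈ Icc 0 L := ⟨le_rfl, hL.le⟩
  have hLL : L ∈ Icc 0 L := ⟨hL.le, le_rfl⟩
  have hdiff : ∀ a ∈ Icc 0 L, ∀ b ∈ Icc 0 L, Q b - Q a = (∫ t in a..b, f t) + (b - a) :=
    fun a ha b hb => by
      rw [← intervalIntegral.integral_interval_sub_left (hfi 0 h0L b hb) (hfi 0 h0L a ha)]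
      ring
  have hgrow : ∀ a ∈ Icc 0 L, ∀ b ∈ Icc 0 L, a ≤ b → b - a ≤ Q b - Q a :=
    fun a ha b hb hab => by
      rw [hdiff a ha b hb]
      linarith [intervalIntegral.integral_nonneg (μ := volume) hab fun t _ => hf0 t]
  have hinj : ∀ a ∈ Icc 0 L, ∀ b ∈ Icc 0 L, Q a ≤ Q b → a ≤ b := fun a ha b hb h => by
    by_contra! hab
    linarith [hgrow b hb a ha hab.le]
  have hcont : ContinuousOn Q (Icc 0 L) := by
    have := intervalIntegral.continuousOn_primitive_interval (f := f) (μ := volume) (a := 0)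
      (b := L) (by
        rw [uIcc_of_le hL.le]
        exact (intervalIntegrable_iff_integrableOn_Icc_of_le hL.le).1 hf)
    rw [uIcc_of_le hL.le] at this
    exact this.add continuousOn_id
  have hQ0 : Q 0 = 0 := by simp [hQ]
  have hQL : 0 < Q L := by linarith [hgrow 0 h0L L hLL hL.le]
  have hn' : (0 : ℝ) < n := Nat.cast_pos.2 hn
  have hex : ∀ j : ℕ, ∃ y ∈ Icc 0 L, Q y = (min j n : ℕ) / (n : ℝ) * Q L := fun j => by
    refine intermediate_value_Icc hL.le hcont ⟨?_, ?_⟩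
    · rw [hQ0]
      positivity
    · refine mul_le_of_le_one_left hQL.le ((div_le_one hn').2 ?_)
      exact_mod_cast min_le_right j n
  choose x hx hxQ using hex
  have hstep : ∀ j, Q (x (j + 1)) - Q (x j) ≤ Q L / n := fun j => by
    rw [hxQ, hxQ, ← sub_mul, ← sub_div, div_mul_eq_mul_div]
    refine div_le_div_of_nonneg_right (mul_le_of_le_one_left hQL.le ?_) hn'.le
    have : min (j + 1) n ≤ min j n + 1 := by omega
    have : ((min (j + 1) n : ℕ) : ℝ) ≤ (min j n : ℕ) + 1 := by exact_mod_cast this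
    linarith
  have hmono : Monotone x := monotone_nat_of_le_succ fun j => by
    refine hinj _ (hx _) _ (hx _) ?_
    rw [hxQ, hxQ]
    have : min j n ≤ min (j + 1) n := by omega
    gcongr
  refine ⟨x, hmono, le_antisymm (hinj _ (hx 0) _ h0L ?_) (hx 0).1,
    le_antisymm (hx n).2 (hinj _ hLL _ (hx n) ?_), hx, fun j => ?_⟩
  · rw [hxQ, hQ0]
    simp
  · rw [hxQ, min_self, div_self hn'.ne', one_mul]
  · have := hstep j
    rw [hdiff _ (hx j) _ (hx _)] at this
    have h2 := hmono (Nat.le_succ j)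
    linarith

/-! ### Concentration of the derivative of an angle of small energy -/

theorem absolutelyContinuous_angleCost_comp {ψ : ℝ → ℝ} {a b : ℝ}
    (hψ : AbsolutelyContinuousOnInterval ψ a b) :
    AbsolutelyContinuousOnInterval (fun x => angleCost (ψ x)) a b := by
  rw [absolutelyContinuousOnInterval_iff] at hψ ⊢
  intro ε hε
  obtain ⟨δ, hδ, h⟩ := hψ ε hε
  refine ⟨δ, hδ, fun E hE hlt => lt_of_le_of_lt (Finset.sum_le_sum fun i _ => ?_) (h E hE hlt)⟩
  simpa using lipschitzWith_angleCost.dist_le_mul (ψ (E.2 i).1) (ψ (E.2 i).2)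

theorem ae_deriv_angleCost_comp {ψ : ℝ → ℝ} {a b : ℝ}
    (hψ : AbsolutelyContinuousOnInterval ψ a b) :
    ∀ᵐ x, x ∈ uIcc a b →
      deriv (fun y => angleCost (ψ y)) x = |Real.sin (ψ x / 2)| * deriv ψ x := by
  filter_upwards [hψ.ae_differentiableAt] with x hx hxI
  exact ((hasDerivAt_angleCost (ψ x)).comp x (hx hxI).hasDerivAt).deriv

/-- The integer `k` for which `2πk` is closest to the angle `t`. -/
noncomputable def nearestTurn (t : ℝ) : ℤ := round (t / (2 * Real.pi))

theorem abs_sub_nearestTurn_le (t : ℝ) : |t - 2 * Real.pi * nearestTurn t| ≤ Real.pi := by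
  have hpi := Real.pi_pos
  have h := abs_sub_round (t / (2 * Real.pi))
  have e : t - 2 * Real.pi * nearestTurn t =
      2 * Real.pi * (t / (2 * Real.pi) - round (t / (2 * Real.pi))) := by
    rw [nearestTurn, mul_sub]
    field_simp
  rw [e, abs_mul, abs_of_pos (by positivity : 0 < 2 * Real.pi)]
  nlinarith

/-- Let `ψ` be an angle with `ψ 0 = 0` and `ψ L` a multiple of `2π`, for which both the variation
of `angleCost ∘ ψ` and the potential `∫ (1 - cos ψ)` are controlled by an energy bound. Then the
measure `ψ' dx` is close to a sum of a bounded number of atoms `± 2π`, and the same atoms with mass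
`4` in place of `2π` describe the derivative of `angleCost ∘ ψ`, which gives the lower bound of
the energy by `8 √2` per atom. -/
theorem exists_atoms {L C : ℝ} (hL : 0 < L) (hC : 0 ≤ C) :
    ∃ (n : ℕ) (D : ℝ), 0 ≤ D ∧ ∀ (ψ : ℝ → ℝ) (E η : ℝ), AbsolutelyContinuousOnInterval ψ 0 L →
      ψ 0 = 0 → (∃ k : ℤ, ψ L = 2 * Real.pi * k) → 0 < η → E ≤ C →
      2 * √2 * ∫ x in (0 : ℝ)..L, |deriv (fun y => angleCost (ψ y)) x| ≤ E →
      ∫ x in (0 : ℝ)..L, (1 - Real.cos (ψ x)) ≤ C * η ^ 2 →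
      ∃ (x : Fin n → Icc (0 : ℝ) L) (c : Fin n → ℤ), (∀ j, |c j| ≤ 1) ∧
        ∀ (A K : ℝ) (φ : Icc (0 : ℝ) L → ℝ), IsTest A K φ →
          |(∫ t in (0 : ℝ)..L, IccExtend hL.le φ t * deriv ψ t) -
              2 * Real.pi * ∑ j, (c j : ℝ) * φ (x j)| ≤ K * (D * η) ∧
          8 * √2 * ∑ j, (c j : ℝ) * φ (x j) ≤ A * E + K * (D * η) := by
  have hpi := Real.pi_pos
  set n : ℕ := ⌈C + L⌉₊ with hn
  set B : ℝ := 9 * Real.pi ^ 2 / 4 with hB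
  refine ⟨n, 2 * √2 * (L + B * C), by positivity, fun ψ E η hψ h0 ⟨k, hk⟩ hη hEC hvar hpot => ?_⟩
  have h22 : 2 ≤ 2 * √2 := by
    have : (1 : ℝ) ≤ √2 := Real.one_le_sqrt.2 (by norm_num)
    linarith
  set g : ℝ → ℝ := fun y => angleCost (ψ y) with hg
  have hgAC : AbsolutelyContinuousOnInterval g 0 L := absolutelyContinuous_angleCost_comp hψ
  have hgi : IntervalIntegrable (fun x => |deriv g x|) volume 0 L :=
    hgAC.intervalIntegrable_deriv.abs
  have hvar0 : 0 ≤ ∫ x in (0 : ℝ)..L, |deriv g x| :=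
    intervalIntegral.integral_nonneg hL.le fun x _ => abs_nonneg _
  obtain ⟨x, hmono, hx0, hxL, hxI, hsmall⟩ :=
    exists_partition hL hgi (fun x => abs_nonneg _) (Nat.succ_pos n)
  have hsmall1 : ∀ j, ∫ t in x j..x (j + 1), |deriv g t| ≤ 1 := fun j => by
    refine (hsmall j).trans ((div_le_one (by positivity)).2 ?_)
    have := Nat.le_ceil (C + L)
    rw [← hn] at this
    push_cast
    nlinarith
  have hsubI : ∀ a ∈ Icc 0 L, ∀ b ∈ Icc 0 L, uIcc a b ⊆ uIcc 0 L := fun a ha b hb => by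
    rw [uIcc_of_le hL.le]
    exact uIcc_subset_Icc ha hb
  -- On the `j`-th interval the angle stays close to `2π (m j)`.
  set m : ℕ → ℤ := fun j => nearestTurn (ψ (x j)) with hm
  have hclose : ∀ j, ∀ t ∈ Icc (x j) (x (j + 1)),
      |ψ t - 2 * Real.pi * m j| ≤ 3 * Real.pi / 2 := fun j t ht => by
    have htI : t ∈ Icc 0 L := ⟨(hxI j).1.trans ht.1, ht.2.trans (hxI (j + 1)).2⟩
    refine abs_le_of_angleCost (abs_sub_nearestTurn_le (ψ (x j))) ?_
    have e : ∀ s : ℝ, angleCost (s - 2 * Real.pi * m j) = angleCost s - 4 * m j := fun s => by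
      have := angleCost_add_int s (-m j)
      push_cast at this
      rw [sub_eq_add_neg, ← mul_neg, this]
      ring
    have e1 : angleCost (ψ t - 2 * Real.pi * m j) -
        angleCost (ψ (x j) - 2 * Real.pi * nearestTurn (ψ (x j))) = g t - g (x j) := by
      rw [e, e]
      ring
    rw [e1, ← (hgAC.mono (hsubI _ (hxI j) _ htI)).integral_deriv_eq_sub]
    refine (intervalIntegral.abs_integral_le_integral_abs ht.1).trans ((?_ : _ ≤ _).trans
      (hsmall1 j))
    refine intervalIntegral.integral_mono_interval le_rfl ht.1 ht.2
      (Eventually.of_forall fun s => abs_nonneg _)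
      (hgAC.mono (hsubI _ (hxI j) _ (hxI (j + 1)))).intervalIntegrable_deriv.abs
  have hm0 : m 0 = 0 := by simp [hm, hx0, h0, nearestTurn]
  have hmn : ψ L = 2 * Real.pi * m n := by
    have h := hclose n L ⟨(hxI n).2, hxL.ge⟩
    rw [hk, ← mul_sub, abs_mul, abs_of_pos (by positivity : 0 < 2 * Real.pi)] at h
    have h1 : |((k - m n : ℤ) : ℝ)| < 1 := by
      push_cast
      by_contra! h1
      nlinarith
    have h2 : |k - m n| < 1 := by exact_mod_cast h1
    rw [hk, sub_eq_zero.1 (Int.abs_lt_one_iff.1 h2)]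
  -- Two multiples of `2π` within distance less than `4π` are equal or adjacent.
  have hjump : ∀ j, |m (j + 1) - m j| ≤ 1 := fun j => by
    have h1 := hclose j (x (j + 1)) ⟨hmono (Nat.le_succ j), le_rfl⟩
    have h2 := abs_sub_nearestTurn_le (ψ (x (j + 1)))
    have h3 : |2 * Real.pi * ((m (j + 1) - m j : ℤ) : ℝ)| < 2 * Real.pi * 2 := by
      push_cast
      rw [abs_le] at h1 h2
      rw [abs_lt]
      constructor <;> simp only [hm] at h1 h2 ⊢ <;> linarith [h1.1, h1.2, h2.1, h2.2]
    rw [abs_mul, abs_of_pos (by positivity : 0 < 2 * Real.pi)] at h3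
    have h4 : |((m (j + 1) - m j : ℤ) : ℝ)| < 2 := lt_of_mul_lt_mul_left h3 (by positivity)
    have h5 : |m (j + 1) - m j| < 2 := by exact_mod_cast h4
    omega
  -- The distance to the step function is controlled by the potential, because of
  -- `|s| ≤ η + s² / η` and `s² ≤ B (1 - cos s)`.
  have hpt : ∀ j, ∀ t ∈ Icc (x j) (x (j + 1)),
      |ψ t - 2 * Real.pi * m j| ≤ η + B / η * (1 - Real.cos (ψ t)) := fun j t ht => by
    have h1 := sq_le_one_sub_cos (hclose j t ht)
    have e : Real.cos (ψ t - 2 * Real.pi * m j) = Real.cos (ψ t) := by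
      rw [mul_comm (2 * Real.pi), Real.cos_sub_int_mul_two_pi]
    rw [e, ← hB, ← sq_abs] at h1
    set s := |ψ t - 2 * Real.pi * m j|
    have h2 : s * η ≤ η ^ 2 + s ^ 2 := by nlinarith [sq_nonneg (s - η), sq_nonneg (s + η)]
    have h3 : s ≤ η + s ^ 2 / η := by
      rw [← le_div_iff₀ hη] at h2
      refine h2.trans (le_of_eq ?_)
      field_simp
    refine h3.trans ?_
    rw [div_mul_eq_mul_div]
    gcongr
  have hψc : ContinuousOn ψ (uIcc 0 L) := hψ.continuousOn
  have hwc : ContinuousOn (fun t => η + B / η * (1 - Real.cos (ψ t))) (uIcc 0 L) :=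
    continuousOn_const.add (continuousOn_const.mul
      (continuousOn_const.sub (Real.continuous_cos.comp_continuousOn hψc)))
  have hdist : ∑ j ∈ Finset.range (n + 1), ∫ t in x j..x (j + 1), |ψ t - 2 * Real.pi * m j| ≤
      (L + B * C) * η := by
    have h1 : ∀ j ∈ Finset.range (n + 1), ∫ t in x j..x (j + 1), |ψ t - 2 * Real.pi * m j| ≤
        ∫ t in x j..x (j + 1), (η + B / η * (1 - Real.cos (ψ t))) := fun j _ =>
      intervalIntegral.integral_mono_on (hmono (Nat.le_succ j))
        ((hψc.mono (hsubI _ (hxI j) _ (hxI (j + 1)))).sub continuousOn_const).abs.intervalIntegrable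
        (hwc.mono (hsubI _ (hxI j) _ (hxI (j + 1)))).intervalIntegrable (hpt j)
    have h2 : IntervalIntegrable (fun t => B / η * (1 - Real.cos (ψ t))) volume 0 L :=
      ContinuousOn.intervalIntegrable (continuousOn_const.mul
        (continuousOn_const.sub (Real.continuous_cos.comp_continuousOn hψc)))
    refine (Finset.sum_le_sum h1).trans ?_
    rw [intervalIntegral.sum_integral_adjacent_intervals fun j _ =>
      (hwc.mono (hsubI _ (hxI j) _ (hxI (j + 1)))).intervalIntegrable, hx0, hxL,
      intervalIntegral.integral_add intervalIntegrable_const h2,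
      intervalIntegral.integral_const_mul, intervalIntegral.integral_const, smul_eq_mul, sub_zero]
    calc L * η + B / η * ∫ t in (0 : ℝ)..L, (1 - Real.cos (ψ t))
        ≤ L * η + B / η * (C * η ^ 2) := by gcongr
      _ = (L + B * C) * η := by field_simp
  have hdist' : ∑ j ∈ Finset.range (n + 1), ∫ t in x j..x (j + 1), |g t - 4 * m j| ≤
      (L + B * C) * η := by
    refine (Finset.sum_le_sum fun j _ => ?_).trans hdist
    have hs := hsubI _ (hxI j) _ (hxI (j + 1))
    refine intervalIntegral.integral_mono_on (hmono (Nat.le_succ j))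
      ((hgAC.continuousOn.mono hs).sub continuousOn_const).abs.intervalIntegrable
      ((hψc.mono hs).sub continuousOn_const).abs.intervalIntegrable fun t _ => ?_
    rw [← angleCost_int]
    simpa [Real.dist_eq] using lipschitzWith_angleCost.dist_le_mul (ψ t) (2 * Real.pi * m j)
  have hη' : (L + B * C) * η ≤ 2 * √2 * (L + B * C) * η := by
    have : 0 ≤ (L + B * C) * η := by positivity
    nlinarith
  refine ⟨fun j => ⟨x (j + 1), hxI _⟩, fun j => m (j + 1) - m j, fun j => hjump j,
    fun A K φ hφ => ?_⟩
  have hφl := hφ.lipschitzWith_extend hL.le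
  have hφx : ∀ j : Fin n, φ ⟨x (j + 1), hxI _⟩ = IccExtend hL.le φ (x (j + 1)) := fun j =>
    (IccExtend_of_mem hL.le φ (hxI _)).symm
  have hsumφ : ∑ j : Fin n, ((m (j + 1) - m j : ℤ) : ℝ) * φ ⟨x (j + 1), hxI _⟩ =
      ∑ j ∈ Finset.range n, ((m (j + 1) : ℝ) - m j) * IccExtend hL.le φ (x (j + 1)) := by
    rw [← Fin.sum_univ_eq_sum_range (fun j => ((m (j + 1) : ℝ) - m j) *
      IccExtend hL.le φ (x (j + 1))) n]
    refine Finset.sum_congr rfl fun j _ => ?_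
    rw [hφx]
    push_cast
    ring
  rw [hsumφ]
  constructor
  · have h := abs_integral_sub_jumps_le hL.le hφl hψ hmono hx0 hxL
      (m := fun j => 2 * Real.pi * m j) (by simp [h0, hm0]) hmn
    rw [Real.coe_toNNReal _ hφ.nonneg_lip] at h
    have e : ∑ j ∈ Finset.range n, (2 * Real.pi * (m (j + 1) : ℝ) - 2 * Real.pi * m j) *
        IccExtend hL.le φ (x (j + 1)) = 2 * Real.pi * ∑ j ∈ Finset.range n,
        ((m (j + 1) : ℝ) - m j) * IccExtend hL.le φ (x (j + 1)) := by
      rw [Finset.mul_sum]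
      exact Finset.sum_congr rfl fun j _ => by ring
    rw [e] at h
    exact h.trans (mul_le_mul_of_nonneg_left (hdist.trans hη') hφ.nonneg_lip)
  · have h := abs_integral_sub_jumps_le hL.le hφl hgAC hmono hx0 hxL
      (m := fun j => 4 * m j) (by simp [hg, h0, hm0, angleCost_zero])
      (by simp only [hg]; rw [hmn, angleCost_int])
    rw [Real.coe_toNNReal _ hφ.nonneg_lip] at h
    have e : ∑ j ∈ Finset.range n, (4 * (m (j + 1) : ℝ) - 4 * m j) *
        IccExtend hL.le φ (x (j + 1)) = 4 * ∑ j ∈ Finset.range n,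
        ((m (j + 1) : ℝ) - m j) * IccExtend hL.le φ (x (j + 1)) := by
      rw [Finset.mul_sum]
      exact Finset.sum_congr rfl fun j _ => by ring
    rw [e] at h
    have h1 := (abs_le.1 (h.trans (mul_le_mul_of_nonneg_left hdist' hφ.nonneg_lip))).1
    have h2 : ∫ t in (0 : ℝ)..L, IccExtend hL.le φ t * deriv g t ≤
        A * ∫ x in (0 : ℝ)..L, |deriv g x| := by
      rw [← intervalIntegral.integral_const_mul]
      refine intervalIntegral.integral_mono_on hL.le
        (hgAC.intervalIntegrable_deriv.continuousOn_mul hφl.continuous.continuousOn)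
        (hgi.const_mul A) fun t _ => (le_abs_self _).trans ?_
      rw [abs_mul]
      exact mul_le_mul_of_nonneg_right (hφ.abs_extend_le hL.le t) (abs_nonneg _)
    have h3 := mul_le_mul_of_nonneg_left hvar hφ.nonneg_bound
    have h4 : 4 * ∑ j ∈ Finset.range n, ((m (j + 1) : ℝ) - m j) * IccExtend hL.le φ (x (j + 1)) ≤
        (A * ∫ x in (0 : ℝ)..L, |deriv g x|) + K * ((L + B * C) * η) := by linarith
    have h5 := mul_le_mul_of_nonneg_left h4 (by positivity : 0 ≤ 2 * √2)
    calc _ = 2 * √2 * (4 * ∑ j ∈ Finset.range n,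
          ((m (j + 1) : ℝ) - m j) * IccExtend hL.le φ (x (j + 1))) := by ring
      _ ≤ 2 * √2 * ((A * ∫ x in (0 : ℝ)..L, |deriv g x|) + K * ((L + B * C) * η)) := h5
      _ = A * (2 * √2 * ∫ x in (0 : ℝ)..L, |deriv g x|) +
          K * (2 * √2 * (L + B * C) * η) := by ring
      _ ≤ _ := by linarith

/-! ### The angle of an admissible curve -/

theorem dx_ae_eq_deriv {F : Type*} [NormedAddCommGroup F] [NormedSpace ℝ F] (L : ℝ) (f : ℝ → F) :
    dx L f =ᵐ[volume.restrict (Icc 0 L)] deriv f := by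
  rw [← Measure.restrict_congr_set Ioo_ae_eq_Icc]
  filter_upwards [self_mem_ae_restrict measurableSet_Ioo] with x hx
  exact derivWithin_of_mem_nhds (Icc_mem_nhds hx.1 hx.2)

theorem IsH1.intervalIntegrable {F : Type*} [NormedAddCommGroup F] [NormedSpace ℝ F] {L : ℝ}
    (hL : 0 ≤ L) {f : ℝ → F} (h : IsH1 L f) : IntervalIntegrable (dx L f) volume 0 L :=
  (intervalIntegrable_iff_integrableOn_Icc_of_le hL).2 (h.1.integrable (by norm_num))

theorem IsH1.absolutelyContinuous {L : ℝ} (hL : 0 ≤ L) {f : ℝ → ℝ} (h : IsH1 L f) :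
    AbsolutelyContinuousOnInterval f 0 L := by
  have h1 := ((h.intervalIntegrable hL).absolutelyContinuousOnInterval_intervalIntegral
    (c := 0) (by simp)).add
    (LipschitzWith.const (f 0)).lipschitzOnWith.absolutelyContinuousOnInterval
  rw [absolutelyContinuousOnInterval_iff] at h1 ⊢
  intro ε hε
  obtain ⟨δ, hδ, h2⟩ := h1 ε hε
  refine ⟨δ, hδ, fun E hE hlt => lt_of_le_of_lt (Finset.sum_le_sum fun i hi => ?_) (h2 E hE hlt)⟩
  have hm := hE.1 i hi
  rw [uIcc_of_le hL] at hm
  simp only [Pi.add_apply]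
  rw [h.2 _ hm.1, h.2 _ hm.2, add_comm (f 0), add_comm (f 0)]

/-- The direction of `q - p` on the `x`-axis: `1` or `-1`. -/
noncomputable def axisSign (p q : Plane) : ℝ := (q 0 - p 0) / dist p q

section Axis

variable {p q : Plane} (hp : p 1 = 0) (hq : q 1 = 0) (hpq : p ≠ q)
include hp hq hpq

theorem sub_eq_axisSign : q - p = (axisSign p q * dist p q) • (!₂[1, 0] : Plane) := by
  have hL : dist p q ≠ 0 := dist_ne_zero.2 hpq
  ext i
  fin_cases i
  · simp [axisSign, hL]
  · simp [hp, hq]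

theorem axisSign_sq : axisSign p q ^ 2 = 1 := by
  have hL : dist p q ≠ 0 := dist_ne_zero.2 hpq
  have h : dist p q ^ 2 = (q 0 - p 0) ^ 2 := by
    rw [EuclideanSpace.dist_eq, Real.sq_sqrt (by positivity)]
    simp [Real.dist_eq, hp, hq]
    ring
  rw [axisSign, div_pow, h, div_self]
  rw [← h]
  positivity

end Axis

/-- `ψ` is the angle between the tangent of the constant speed curve `Υ` and the direction of
`q - p`, normalized to vanish at `0`. The other fields record what the boundary conditions of an
admissible curve mean for `ψ`. -/
structure IsAngle (p q : Plane) (Υ : ℝ → Plane) (κ ψ : ℝ → ℝ) : Prop where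
  ac : AbsolutelyContinuousOnInterval ψ 0 (dist p q)
  memLp : MemLp (deriv ψ) 2 (volume.restrict (Icc 0 (dist p q)))
  start : ψ 0 = 0
  last : ∃ k : ℤ, ψ (dist p q) = 2 * Real.pi * k
  length_pos : 0 < length (dist p q) Υ
  length_mul : length (dist p q) Υ * ∫ x in (0 : ℝ)..dist p q, Real.cos (ψ x) = dist p q ^ 2
  curvature : ∀ᵐ x ∂(volume.restrict (Icc 0 (dist p q))),
    κ x = dist p q / length (dist p q) Υ * deriv ψ x
  tangent : ∀ x ∈ Icc 0 (dist p q), dx (dist p q) Υ x =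
    (length (dist p q) Υ / dist p q * axisSign p q) •
      (!₂[Real.cos (ψ x), Real.sin (ψ x)] : Plane)

theorem coord_integral {f : ℝ → Plane} {a b : ℝ} (hf : IntervalIntegrable f volume a b)
    (i : Fin 2) : (∫ x in a..b, f x) i = ∫ x in a..b, f x i :=
  ((EuclideanSpace.proj i : Plane →L[ℝ] ℝ).intervalIntegral_comp_comm hf).symm

/-- The lifting `θ` of the tangent starts at a multiple of `π`, which has the parity given by the
direction of `q - p`; the angle is `θ - θ 0`. -/
theorem IsAdmissible.exists_isAngle {p q : Plane} (hp : p 1 = 0) (hq : q 1 = 0) (hpq : p ≠ q)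
    {Υ : ℝ → Plane} {κ : ℝ → ℝ} (h : IsAdmissible p q Υ κ) : ∃ ψ, IsAngle p q Υ κ ψ := by
  have hL : 0 < dist p q := dist_pos.2 hpq
  have hsub := sub_eq_axisSign hp hq hpq
  have hs2 := axisSign_sq hp hq hpq
  obtain ⟨θ, hθ, htan, hκ⟩ := h.curvature
  have hf0 := h.forward_start
  have hfL := h.forward_end
  have hh0 := h.horizontal_start
  have hhL := h.horizontal_end
  have hli := h.isH2.1.intervalIntegrable hL.le
  have hend := h.isH2.1.2 _ ⟨hL.le, le_rfl⟩
  rw [h.start_eq, h.end_eq] at hend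
  rw [htan 0 ⟨le_rfl, hL.le⟩] at hf0 hh0
  rw [htan _ ⟨hL.le, le_rfl⟩] at hfL hhL
  rw [hsub] at hf0 hfL
  set L := dist p q with hLdef
  set ℓ := length L Υ with hℓ
  set σ := axisSign p q with hσ
  have hℓ0 : 0 ≤ ℓ := intervalIntegral.integral_nonneg hL.le fun x _ => norm_nonneg _
  simp only [inner_smul_left, inner_smul_right, PiLp.inner_apply, Fin.sum_univ_two] at hf0 hfL
  simp at hf0 hfL hh0 hhL
  have hℓpos : 0 < ℓ := by
    rcases hℓ0.eq_or_lt with h0 | h0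
    · rw [← h0] at hf0
      simp at hf0
    · exact h0
  -- A horizontal unit vector pointing in the direction `σ` is `(σ, 0)`.
  have horiz : ∀ t : ℝ, 0 < σ * L * (ℓ / L * Real.cos t) → (ℓ = 0 ∨ L = 0) ∨ Real.sin t = 0 →
      Real.cos t = σ ∧ Real.sin t = 0 := fun t h1 h2 => by
    have h3 : Real.sin t = 0 := by
      rcases h2 with (h2 | h2) | h2
      · exact absurd h2 hℓpos.ne'
      · exact absurd h2 hL.ne'
      · exact h2
    refine ⟨?_, h3⟩
    have h4 : Real.cos t ^ 2 = σ ^ 2 := by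
      rw [hs2]
      have := Real.sin_sq_add_cos_sq t
      rw [h3] at this
      linarith
    have h5 : 0 < ℓ * (σ * Real.cos t) := by
      calc 0 < σ * L * (ℓ / L * Real.cos t) := h1
        _ = _ := by field_simp
    have h6 : 0 < σ * Real.cos t := pos_of_mul_pos_right h5 hℓ0
    rcases sq_eq_sq_iff_eq_or_eq_neg.1 h4 with h7 | h7
    · exact h7
    · rw [h7] at h6
      nlinarith
  obtain ⟨c0, s0⟩ := horiz (θ 0) (by linarith) hh0
  obtain ⟨cL, sL⟩ := horiz (θ L) (by linarith) hhL
  have hcos : ∀ x, Real.cos (θ x) = σ * Real.cos (θ x - θ 0) := fun x => by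
    rw [Real.cos_sub, c0, s0]
    linear_combination (-Real.cos (θ x)) * hs2
  have hsin : ∀ x, Real.sin (θ x) = σ * Real.sin (θ x - θ 0) := fun x => by
    rw [Real.sin_sub, c0, s0]
    linear_combination (-Real.sin (θ x)) * hs2
  have htan' : ∀ x ∈ Icc 0 L, dx L Υ x = (ℓ / L * σ) •
      (!₂[Real.cos (θ x - θ 0), Real.sin (θ x - θ 0)] : Plane) := fun x hx => by
    rw [htan x hx, hcos, hsin, mul_smul]
    congr 1
    ext i
    fin_cases i <;> simp
  have hd : ∀ x, deriv (fun y => θ y - θ 0) x = deriv θ x := fun x => by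
    rw [deriv_sub_const]
  have hdx := dx_ae_eq_deriv L θ
  refine ⟨fun x => θ x - θ 0, ?_, ?_, sub_self _, ?_, hℓpos, ?_, ?_, htan'⟩
  · exact (hθ.absolutelyContinuous hL.le).sub
      (LipschitzWith.const (θ 0)).lipschitzOnWith.absolutelyContinuousOnInterval
  · refine (memLp_congr_ae (hdx.mono fun x hx => ?_)).1 hθ.1
    rw [hd, hx]
  · obtain ⟨k, hk⟩ := (Real.cos_eq_one_iff (θ L - θ 0)).1 (by
      rw [Real.cos_sub, cL, c0, s0, sL, ← sq, hs2]
      ring)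
    exact ⟨k, by rw [← hk]; ring⟩
  · have h0 := congrArg (fun v : Plane => v 0) hend
    have hs0 := congrArg (fun v : Plane => v 0) hsub
    simp only [PiLp.add_apply, coord_integral hli] at h0
    simp at hs0
    have e : ∫ x in (0 : ℝ)..L, dx L Υ x 0 =
        ℓ / L * σ * ∫ x in (0 : ℝ)..L, Real.cos (θ x - θ 0) := by
      rw [← intervalIntegral.integral_const_mul]
      refine intervalIntegral.integral_congr fun x hx => ?_
      rw [uIcc_of_le hL.le] at hx
      simp only
      rw [htan' x hx]
      simp
    rw [e] at h0
    have hσ0 : σ ≠ 0 := by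
      rintro h0
      rw [h0] at hs2
      norm_num at hs2
    have h1 : σ * L = ℓ / L * σ * ∫ x in (0 : ℝ)..L, Real.cos (θ x - θ 0) := by
      rw [← hs0]
      linarith
    field_simp at h1
    linarith
  · filter_upwards [hκ, hdx] with x hx hx'
    rw [hx, hd, hx']

namespace IsAngle

variable {p q : Plane} {Υ : ℝ → Plane} {κ ψ : ℝ → ℝ}

theorem intervalIntegrable_cos (h : IsAngle p q Υ κ ψ) :
    IntervalIntegrable (fun x => Real.cos (ψ x)) volume 0 (dist p q) :=
  (Real.continuous_cos.comp_continuousOn h.ac.continuousOn).intervalIntegrable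

theorem dist_le_length (hpq : p ≠ q) (h : IsAngle p q Υ κ ψ) :
    dist p q ≤ length (dist p q) Υ := by
  have hL : 0 < dist p q := dist_pos.2 hpq
  have h1 : ∫ x in (0 : ℝ)..dist p q, Real.cos (ψ x) ≤ ∫ x in (0 : ℝ)..dist p q, (1 : ℝ) :=
    intervalIntegral.integral_mono_on hL.le h.intervalIntegrable_cos intervalIntegrable_const
      fun x _ => Real.cos_le_one _
  simp only [intervalIntegral.integral_const, sub_zero, smul_eq_mul, mul_one] at h1
  have h2 := mul_le_mul_of_nonneg_left h1 h.length_pos.le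
  rw [h.length_mul] at h2
  nlinarith

/-- The excess length is the integral of the potential `1 - cos ψ` with respect to arclength. -/
theorem length_sub_dist (hpq : p ≠ q) (h : IsAngle p q Υ κ ψ) :
    length (dist p q) Υ - dist p q = length (dist p q) Υ / dist p q *
      ∫ x in (0 : ℝ)..dist p q, (1 - Real.cos (ψ x)) := by
  have hL : 0 < dist p q := dist_pos.2 hpq
  rw [intervalIntegral.integral_sub intervalIntegrable_const h.intervalIntegrable_cos]
  simp only [intervalIntegral.integral_const, sub_zero, smul_eq_mul, mul_one]
  rw [div_mul_eq_mul_div, mul_sub, h.length_mul]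
  field_simp

theorem intervalIntegrable_deriv_sq (h : IsAngle p q Υ κ ψ) :
    IntervalIntegrable (fun x => deriv ψ x ^ 2) volume 0 (dist p q) :=
  (intervalIntegrable_iff_integrableOn_Icc_of_le dist_nonneg).2 h.memLp.integrable_sq

/-- The energy in terms of the angle. -/
theorem energy_eq (hpq : p ≠ q) (h : IsAngle p q Υ κ ψ) (ε : ℝ) :
    energy p q ε Υ κ = √ε * (dist p q / length (dist p q) Υ *
      ∫ x in (0 : ℝ)..dist p q, deriv ψ x ^ 2) +
      (√ε)⁻¹ * (length (dist p q) Υ - dist p q) := by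
  have hL : 0 < dist p q := dist_pos.2 hpq
  have hℓ := h.length_pos
  have e : ∫ x in (0 : ℝ)..dist p q, κ x ^ 2 = (dist p q / length (dist p q) Υ) ^ 2 *
      ∫ x in (0 : ℝ)..dist p q, deriv ψ x ^ 2 := by
    rw [← intervalIntegral.integral_const_mul, intervalIntegral.integral_of_le hL.le,
      intervalIntegral.integral_of_le hL.le, ← integral_Icc_eq_integral_Ioc,
      ← integral_Icc_eq_integral_Ioc]
    refine integral_congr_ae (h.curvature.mono fun x hx => ?_)
    simp only
    rw [hx]
    ring
  rw [energy, e]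
  field_simp

theorem length_sub_le (hpq : p ≠ q) (h : IsAngle p q Υ κ ψ) {ε : ℝ} (hε : 0 < ε) :
    length (dist p q) Υ - dist p q ≤ √ε * energy p q ε Υ κ := by
  have hs : 0 < √ε := Real.sqrt_pos.2 hε
  have h1 : 0 ≤ ∫ x in (0 : ℝ)..dist p q, deriv ψ x ^ 2 :=
    intervalIntegral.integral_nonneg dist_nonneg fun x _ => sq_nonneg _
  have h2 : 0 ≤ √ε * (dist p q / length (dist p q) Υ *
      ∫ x in (0 : ℝ)..dist p q, deriv ψ x ^ 2) :=
    mul_nonneg hs.le (mul_nonneg (div_nonneg dist_nonneg h.length_pos.le) h1)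
  rw [h.energy_eq hpq, mul_add, mul_inv_cancel_left₀ hs.ne']
  linarith [mul_nonneg hs.le h2]

/-- Young's inequality bounds the energy from below by the variation of `angleCost ∘ ψ`. -/
theorem variation_le_energy (hpq : p ≠ q) (h : IsAngle p q Υ κ ψ) {ε : ℝ} (hε : 0 < ε) :
    2 * √2 * ∫ x in (0 : ℝ)..dist p q, |deriv (fun y => angleCost (ψ y)) x| ≤
      energy p q ε Υ κ := by
  have hL : 0 < dist p q := dist_pos.2 hpq
  have hℓ := h.length_pos
  have hs : 0 < √ε := Real.sqrt_pos.2 hε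
  set r := √ε * (dist p q / length (dist p q) Υ) with hr
  have hr0 : 0 < r := by positivity
  have hpoti : IntervalIntegrable (fun x => 1 - Real.cos (ψ x)) volume 0 (dist p q) :=
    intervalIntegrable_const.sub h.intervalIntegrable_cos
  have e : energy p q ε Υ κ = ∫ x in (0 : ℝ)..dist p q,
      (r * deriv ψ x ^ 2 + r⁻¹ * (1 - Real.cos (ψ x))) := by
    rw [intervalIntegral.integral_add (h.intervalIntegrable_deriv_sq.const_mul _)
      (hpoti.const_mul _), intervalIntegral.integral_const_mul,
      intervalIntegral.integral_const_mul, h.energy_eq hpq, h.length_sub_dist hpq, hr]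
    field_simp
  rw [e, ← intervalIntegral.integral_const_mul]
  refine intervalIntegral.integral_mono_ae_restrict hL.le ?_ ?_ ?_
  · exact (absolutelyContinuous_angleCost_comp h.ac).intervalIntegrable_deriv.abs.const_mul _
  · exact (h.intervalIntegrable_deriv_sq.const_mul _).add (hpoti.const_mul _)
  · have hd := ae_deriv_angleCost_comp h.ac
    rw [uIcc_of_le hL.le] at hd
    rw [Filter.EventuallyLE, ae_restrict_iff' measurableSet_Icc]
    filter_upwards [hd] with x hx hxI
    rw [hx hxI, abs_mul, abs_abs]
    have h2 : Real.cos (ψ x) = 1 - 2 * |Real.sin (ψ x / 2)| ^ 2 := by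
      rw [sq_abs, Real.sin_sq_eq_half_sub]
      ring_nf
    rw [h2, ← sq_abs (deriv ψ x)]
    set a := |Real.sin (ψ x / 2)|
    set b := |deriv ψ x|
    have h3 : √2 ^ 2 = 2 := Real.sq_sqrt (by norm_num)
    have h4 : r * b ^ 2 + r⁻¹ * (1 - (1 - 2 * a ^ 2)) - 2 * √2 * (a * b) =
        r⁻¹ * (r * b - √2 * a) ^ 2 := by
      field_simp
      linear_combination (-a ^ 2) * h3
    have h5 : 0 ≤ r⁻¹ * (r * b - √2 * a) ^ 2 := by positivity
    linarith

theorem integrableOn_curvature (h : IsAngle p q Υ κ ψ) : IntegrableOn κ (Icc 0 (dist p q)) :=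
  ((h.memLp.integrable (by norm_num)).const_mul _).congr (h.curvature.mono fun _ hx => hx.symm)

theorem integral_curvature (h : IsAngle p q Υ κ ψ) {A K : ℝ}
    {φ : Icc (0 : ℝ) (dist p q) → ℝ} (hφ : IsTest A K φ) :
    ∫ᵛ x, φ x ∂•(densityMeasure (dist p q) κ) = dist p q / length (dist p q) Υ *
      ∫ x in (0 : ℝ)..dist p q, IccExtend dist_nonneg φ x * deriv ψ x := by
  rw [integral_densityMeasure dist_nonneg hφ h.integrableOn_curvature,
    ← intervalIntegral.integral_const_mul, intervalIntegral.integral_of_le dist_nonneg,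
    intervalIntegral.integral_of_le dist_nonneg, ← integral_Icc_eq_integral_Ioc,
    ← integral_Icc_eq_integral_Ioc]
  refine integral_congr_ae (h.curvature.mono fun x hx => ?_)
  simp only
  rw [hx]
  ring

end IsAngle

/-! ### Convergence of the curves to the segment -/

/-- The segment from `p` to `q`, parametrized on `[0, |p - q|]`. -/
noncomputable def segmentCurve (p q : Plane) (t : ℝ) : Plane := p + (t / dist p q) • (q - p)

theorem hasDerivAt_segmentCurve (p q : Plane) (t : ℝ) :
    HasDerivAt (segmentCurve p q) ((1 / dist p q) • (q - p)) t :=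
  (((hasDerivAt_id t).div_const _).smul_const (q - p)).const_add p

theorem dx_eq_of_eqOn_segmentCurve {p q : Plane} (hpq : p ≠ q) {Υ₀ : ℝ → Plane}
    (h : EqOn Υ₀ (segmentCurve p q) (Icc 0 (dist p q))) {x : ℝ} (hx : x ∈ Icc 0 (dist p q)) :
    dx (dist p q) Υ₀ x = (1 / dist p q) • (q - p) := by
  rw [dx, derivWithin_congr h (h hx)]
  exact (hasDerivAt_segmentCurve p q x).hasDerivWithinAt.derivWithin
    (uniqueDiffOn_Icc (dist_pos.2 hpq) x hx)

theorem IsAngle.norm_dx_sub_sq {p q : Plane} (hp : p 1 = 0) (hq : q 1 = 0) (hpq : p ≠ q)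
    {Υ : ℝ → Plane} {κ ψ : ℝ → ℝ} (h : IsAngle p q Υ κ ψ) {x : ℝ}
    (hx : x ∈ Icc 0 (dist p q)) :
    ‖dx (dist p q) Υ x - (1 / dist p q) • (q - p)‖ ^ 2 =
      (length (dist p q) Υ / dist p q) ^ 2 + 1 -
        2 * (length (dist p q) Υ / dist p q) * Real.cos (ψ x) := by
  have hL : 0 < dist p q := dist_pos.2 hpq
  rw [h.tangent x hx]
  rw [sub_eq_axisSign hp hq hpq]
  have hs := axisSign_sq hp hq hpq
  rw [EuclideanSpace.norm_sq_eq, Fin.sum_univ_two, smul_smul,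
    show 1 / dist p q * (axisSign p q * dist p q) = axisSign p q by field_simp]
  generalize length (dist p q) Υ / dist p q = r
  simp only [PiLp.sub_apply, PiLp.smul_apply, smul_eq_mul, Real.norm_eq_abs, sq_abs]
  simp only [Matrix.cons_val_zero, Matrix.cons_val_one, mul_one, mul_zero, sub_zero]
  have := Real.sin_sq_add_cos_sq (ψ x)
  linear_combination (r ^ 2 * Real.cos (ψ x) ^ 2 + r ^ 2 * Real.sin (ψ x) ^ 2 + 1 -
    2 * r * Real.cos (ψ x)) * hs + r ^ 2 * this

/-- The `L²` distance of the tangents is determined by the length. -/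
theorem eLpNorm_dx_sub {p q : Plane} (hp : p 1 = 0) (hq : q 1 = 0) (hpq : p ≠ q)
    {Υ : ℝ → Plane} {κ : ℝ → ℝ} (h : IsAdmissible p q Υ κ) {Υ₀ : ℝ → Plane}
    (h₀ : EqOn Υ₀ (segmentCurve p q) (Icc 0 (dist p q))) :
    eLpNorm (fun x => dx (dist p q) Υ x - dx (dist p q) Υ₀ x) 2
      (volume.restrict (Icc 0 (dist p q))) = ENNReal.ofReal
        (((length (dist p q) Υ ^ 2 - dist p q ^ 2) / dist p q) ^ (2⁻¹ : ℝ)) := by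
  have hL : 0 < dist p q := dist_pos.2 hpq
  obtain ⟨ψ, hψ⟩ := h.exists_isAngle hp hq hpq
  set v : Plane := (1 / dist p q) • (q - p) with hv
  have e : eLpNorm (fun x => dx (dist p q) Υ x - dx (dist p q) Υ₀ x) 2
      (volume.restrict (Icc 0 (dist p q))) = eLpNorm (fun x => dx (dist p q) Υ x - v) 2
      (volume.restrict (Icc 0 (dist p q))) := by
    refine eLpNorm_congr_ae ?_
    filter_upwards [self_mem_ae_restrict measurableSet_Icc] with x hx
    rw [dx_eq_of_eqOn_segmentCurve hpq h₀ hx]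
  have hm : MemLp (fun x => dx (dist p q) Υ x - v) 2 (volume.restrict (Icc 0 (dist p q))) :=
    h.isH2.1.1.sub (memLp_const v)
  rw [e, hm.eLpNorm_eq_integral_rpow_norm (by norm_num) (by norm_num)]
  simp only [ENNReal.toReal_ofNat, Real.rpow_two]
  congr 2
  rw [integral_Icc_eq_integral_Ioc, ← intervalIntegral.integral_of_le hL.le]
  have e2 : ∫ x in (0 : ℝ)..dist p q, ‖dx (dist p q) Υ x - v‖ ^ 2 =
      ∫ x in (0 : ℝ)..dist p q, ((length (dist p q) Υ / dist p q) ^ 2 + 1 -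
        2 * (length (dist p q) Υ / dist p q) * Real.cos (ψ x)) := by
    refine intervalIntegral.integral_congr fun x hx => ?_
    rw [uIcc_of_le hL.le] at hx
    exact hψ.norm_dx_sub_sq hp hq hpq hx
  rw [e2, intervalIntegral.integral_sub intervalIntegrable_const
    (hψ.intervalIntegrable_cos.const_mul _), intervalIntegral.integral_const_mul]
  simp only [intervalIntegral.integral_const, sub_zero, smul_eq_mul]
  have := hψ.length_mul
  field_simp
  linear_combination (-2) * this

/-- Since all curves start at `p`, the curves are as close as their tangents. -/
theorem eLpNorm_curve_sub_le {p q : Plane} (hpq : p ≠ q) {Υ : ℝ → Plane} {κ : ℝ → ℝ}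
    (h : IsAdmissible p q Υ κ) {Υ₀ : ℝ → Plane}
    (h₀ : EqOn Υ₀ (segmentCurve p q) (Icc 0 (dist p q))) :
    eLpNorm (fun x => Υ x - Υ₀ x) 2 (volume.restrict (Icc 0 (dist p q))) ≤
      eLpNorm (fun x => dx (dist p q) Υ x - dx (dist p q) Υ₀ x) 2
        (volume.restrict (Icc 0 (dist p q))) *
      (volume (Icc 0 (dist p q)) ^ (1 / 2 : ℝ) * volume (Icc 0 (dist p q)) ^ (2⁻¹ : ℝ)) := by
  have hL : 0 < dist p q := dist_pos.2 hpq
  set v : Plane := (1 / dist p q) • (q - p) with hv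
  set f : ℝ → Plane := fun x => dx (dist p q) Υ x - v with hf
  have e : eLpNorm (fun x => dx (dist p q) Υ x - dx (dist p q) Υ₀ x) 2
      (volume.restrict (Icc 0 (dist p q))) = eLpNorm f 2
      (volume.restrict (Icc 0 (dist p q))) := by
    refine eLpNorm_congr_ae ?_
    filter_upwards [self_mem_ae_restrict measurableSet_Icc] with x hx
    rw [dx_eq_of_eqOn_segmentCurve hpq h₀ hx]
  have hfm : MemLp f 2 (volume.restrict (Icc 0 (dist p q))) := h.isH2.1.1.sub (memLp_const v)
  have h1 : ∀ x ∈ Icc 0 (dist p q), ‖Υ x - Υ₀ x‖ₑ ≤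
      eLpNorm f 1 (volume.restrict (Icc 0 (dist p q))) := fun x hx => by
    have hi : IntervalIntegrable (dx (dist p q) Υ) volume 0 x :=
      (h.isH2.1.intervalIntegrable hL.le).mono_set (by
        rw [uIcc_of_le hL.le, uIcc_of_le hx.1]
        exact Icc_subset_Icc_right hx.2)
    have e3 : Υ x - Υ₀ x = ∫ t in (0 : ℝ)..x, f t := by
      rw [hf, intervalIntegral.integral_sub hi intervalIntegrable_const,
        intervalIntegral.integral_const, sub_zero, h.isH2.1.2 x hx, h.start_eq, h₀ hx,
        segmentCurve, hv, smul_smul, mul_one_div]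
      abel
    rw [e3, intervalIntegral.integral_of_le hx.1, eLpNorm_one_eq_lintegral_enorm]
    exact (enorm_integral_le_lintegral_enorm _).trans (lintegral_mono_set
      (Ioc_subset_Icc_self.trans (Icc_subset_Icc_right hx.2)))
  have h2 := eLpNorm_le_of_ae_enorm_bound (p := 2) (μ := volume.restrict (Icc 0 (dist p q)))
    (f := fun x => Υ x - Υ₀ x) (by
      filter_upwards [self_mem_ae_restrict measurableSet_Icc] with x hx using h1 x hx)
  have h3 := eLpNorm_le_eLpNorm_mul_rpow_measure_univ (p := 1) (q := 2) (by norm_num)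
    hfm.aestronglyMeasurable
  rw [e]
  refine h2.trans ?_
  rw [smul_eq_mul, Measure.restrict_apply_univ] at *
  rw [← mul_assoc]
  refine mul_le_mul' (h3.trans (le_of_eq ?_)) (le_of_eq ?_)
  · norm_num
  · norm_num

theorem tendsto_curves {ι : Type*} {l : Filter ι} {p q : Plane} (hp : p 1 = 0) (hq : q 1 = 0)
    (hpq : p ≠ q) {Υ : ι → ℝ → Plane} {κ : ι → ℝ → ℝ} (h : ∀ i, IsAdmissible p q (Υ i) (κ i))
    (hlen : Tendsto (fun i => length (dist p q) (Υ i)) l (𝓝 (dist p q))) {Υ₀ : ℝ → Plane}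
    (h₀ : EqOn Υ₀ (segmentCurve p q) (Icc 0 (dist p q))) :
    Tendsto (fun i => eLpNorm (fun x => Υ i x - Υ₀ x) 2
      (volume.restrict (Icc 0 (dist p q)))) l (𝓝 0) ∧
    Tendsto (fun i => eLpNorm (fun x => dx (dist p q) (Υ i) x - dx (dist p q) Υ₀ x) 2
      (volume.restrict (Icc 0 (dist p q)))) l (𝓝 0) := by
  have h2 : Tendsto (fun i => eLpNorm (fun x => dx (dist p q) (Υ i) x - dx (dist p q) Υ₀ x) 2
      (volume.restrict (Icc 0 (dist p q)))) l (𝓝 0) := by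
    simp_rw [fun i => eLpNorm_dx_sub hp hq hpq (h i) h₀]
    have h3 : Tendsto (fun i => (length (dist p q) (Υ i) ^ 2 - dist p q ^ 2) / dist p q) l
        (𝓝 0) := by
      have := ((hlen.pow 2).sub_const (dist p q ^ 2)).div_const (dist p q)
      rwa [sub_self, zero_div] at this
    have h4 := h3.rpow_const (p := (2⁻¹ : ℝ)) (Or.inr (by norm_num))
    rw [Real.zero_rpow (by norm_num)] at h4
    simpa only [ENNReal.ofReal_zero] using! (ENNReal.continuous_ofReal.tendsto 0).comp h4
  refine ⟨?_, h2⟩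
  have hfin : volume (Icc 0 (dist p q)) ^ (1 / 2 : ℝ) * volume (Icc 0 (dist p q)) ^ (2⁻¹ : ℝ) ≠
      ∞ := ENNReal.mul_ne_top (ENNReal.rpow_ne_top_of_nonneg (by norm_num) (by simp))
    (ENNReal.rpow_ne_top_of_nonneg (by norm_num) (by simp))
  have h5 := ENNReal.Tendsto.mul_const h2 (Or.inr hfin)
  rw [zero_mul] at h5
  exact tendsto_of_tendsto_of_tendsto_of_le_of_le tendsto_const_nhds h5 (fun i => zero_le)
    fun i => eLpNorm_curve_sub_le hpq (h i) h₀

theorem tendsto_length {ι : Type*} {l : Filter ι} {p q : Plane} (hp : p 1 = 0) (hq : q 1 = 0)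
    (hpq : p ≠ q) {Υ : ι → ℝ → Plane} {κ : ι → ℝ → ℝ} (h : ∀ i, IsAdmissible p q (Υ i) (κ i))
    {ε : ι → ℝ} (hε : Tendsto ε l (𝓝[>] 0)) {C : ℝ}
    (hC : ∀ᶠ i in l, energy p q (ε i) (Υ i) (κ i) ≤ C) :
    Tendsto (fun i => length (dist p q) (Υ i)) l (𝓝 (dist p q)) := by
  rw [tendsto_nhdsWithin_iff] at hε
  have h1 : Tendsto (fun i => dist p q + √(ε i) * C) l (𝓝 (dist p q)) := by
    have := (((Real.continuous_sqrt.tendsto 0).comp hε.1).mul_const C).const_add (dist p q)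
    simpa using! this
  refine tendsto_of_tendsto_of_tendsto_of_le_of_le' tendsto_const_nhds h1
    (Eventually.of_forall fun i => ?_) ?_
  · obtain ⟨ψ, hψ⟩ := (h i).exists_isAngle hp hq hpq
    exact hψ.dist_le_length hpq
  · filter_upwards [hε.2, hC] with i hi hCi
    obtain ⟨ψ, hψ⟩ := (h i).exists_isAngle hp hq hpq
    have h2 := hψ.length_sub_le hpq hi
    have h3 := mul_le_mul_of_nonneg_left hCi (Real.sqrt_nonneg (ε i))
    linarith

/-! ### Atoms of an admissible curve -/

/-- The curvature of an admissible curve of bounded energy is close to a bounded number of atoms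
`± 2π`, each of which costs the energy `8 √2`. -/
theorem exists_atoms_of_isAdmissible {p q : Plane} (hp : p 1 = 0) (hq : q 1 = 0) (hpq : p ≠ q)
    {C : ℝ} (hC : 0 ≤ C) :
    ∃ (n : ℕ) (D : ℝ), 0 ≤ D ∧ ∀ (ε : ℝ) (Υ : ℝ → Plane) (κ : ℝ → ℝ), ε ∈ Ioc (0 : ℝ) 1 →
      IsAdmissible p q Υ κ → energy p q ε Υ κ ≤ C →
      ∃ (x : Fin n → Icc (0 : ℝ) (dist p q)) (c : Fin n → ℤ), (∀ j, |c j| ≤ 1) ∧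
        ∀ (A K : ℝ) (φ : Icc (0 : ℝ) (dist p q) → ℝ), IsTest A K φ →
          |(∫ᵛ x, φ x ∂•(densityMeasure (dist p q) κ)) -
              2 * Real.pi * ∑ j, (c j : ℝ) * φ (x j)| ≤ (A + K) * (D * √(√ε)) ∧
          8 * √2 * ∑ j, (c j : ℝ) * φ (x j) ≤
            A * energy p q ε Υ κ + K * (D * √(√ε)) := by
  have hL : 0 < dist p q := dist_pos.2 hpq
  obtain ⟨n, D, hD, key⟩ := exists_atoms hL hC
  have hpi := Real.pi_pos
  refine ⟨n, D + C / dist p q * (2 * Real.pi * n), by positivity,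
    fun ε Υ κ hε hadm hE => ?_⟩
  obtain ⟨ψ, hψ⟩ := hadm.exists_isAngle hp hq hpq
  have hs : 0 < √ε := Real.sqrt_pos.2 hε.1
  have hη : 0 < √(√ε) := Real.sqrt_pos.2 hs
  have hη2 : √(√ε) ^ 2 = √ε := Real.sq_sqrt hs.le
  have hη1 : √(√ε) ≤ 1 := by
    rw [Real.sqrt_le_one, Real.sqrt_le_one]
    exact hε.2
  have hlen := hψ.dist_le_length hpq
  have hexc : length (dist p q) Υ - dist p q ≤ C * √(√ε) ^ 2 := by
    rw [hη2, mul_comm]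
    exact (hψ.length_sub_le hpq hε.1).trans (mul_le_mul_of_nonneg_left hE hs.le)
  have hpot : ∫ x in (0 : ℝ)..dist p q, (1 - Real.cos (ψ x)) ≤ C * √(√ε) ^ 2 := by
    refine le_trans ?_ hexc
    rw [hψ.length_sub_dist hpq]
    refine le_mul_of_one_le_left (intervalIntegral.integral_nonneg hL.le fun x _ => ?_)
      ((one_le_div hL).2 hlen)
    linarith [Real.cos_le_one (ψ x)]
  obtain ⟨x, c, hc, hxc⟩ := key ψ (energy p q ε Υ κ) (√(√ε)) hψ.ac hψ.start hψ.last hη hE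
    (hψ.variation_le_energy hpq hε.1) hpot
  refine ⟨x, c, hc, fun A K φ hφ => ?_⟩
  obtain ⟨h1, h2⟩ := hxc A K φ hφ
  have hA := hφ.nonneg_bound
  have hK := hφ.nonneg_lip
  set η := √(√ε)
  have hextra : 0 ≤ C / dist p q * (2 * Real.pi * n) * η := by positivity
  constructor
  · rw [hψ.integral_curvature hφ]
    set X := ∫ t in (0 : ℝ)..dist p q, IccExtend dist_nonneg φ t * deriv ψ t
    set Y := 2 * Real.pi * ∑ j, (c j : ℝ) * φ (x j) with hY
    set ℓ := length (dist p q) Υ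
    have hℓ : 0 < ℓ := hψ.length_pos
    have hr1 : dist p q / ℓ ≤ 1 := (div_le_one hℓ).2 hlen
    have hr2 : 1 - dist p q / ℓ ≤ C / dist p q * η := by
      have : 1 - dist p q / ℓ = (ℓ - dist p q) / ℓ := by field_simp
      rw [this]
      calc (ℓ - dist p q) / ℓ ≤ (ℓ - dist p q) / dist p q :=
            div_le_div_of_nonneg_left (by linarith) hL hlen
        _ ≤ C * η ^ 2 / dist p q := div_le_div_of_nonneg_right hexc hL.le
        _ = C / dist p q * η * η := by ring
        _ ≤ C / dist p q * η := mul_le_of_le_one_right (by positivity) hη1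
    have hYb : |Y| ≤ 2 * Real.pi * n * A := by
      rw [hY, abs_mul, abs_of_pos Real.two_pi_pos, mul_assoc (2 * Real.pi)]
      refine mul_le_mul_of_nonneg_left ((Finset.abs_sum_le_sum_abs _ _).trans ?_)
        Real.two_pi_pos.le
      have : ∀ j ∈ Finset.univ, |(c j : ℝ) * φ (x j)| ≤ A := fun j _ => by
        rw [abs_mul]
        have hcj : |(c j : ℝ)| ≤ 1 := by exact_mod_cast hc j
        calc |(c j : ℝ)| * |φ (x j)| ≤ 1 * A :=
              mul_le_mul hcj (hφ.bound _) (abs_nonneg _) zero_le_one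
          _ = A := one_mul A
      refine (Finset.sum_le_sum this).trans (le_of_eq ?_)
      simp
    calc |dist p q / ℓ * X - Y|
        = |dist p q / ℓ * (X - Y) - (1 - dist p q / ℓ) * Y| := by ring_nf
      _ ≤ dist p q / ℓ * |X - Y| + (1 - dist p q / ℓ) * |Y| := by
          refine (abs_sub _ _).trans (le_of_eq ?_)
          rw [abs_mul, abs_mul, abs_of_pos (div_pos hL hℓ), abs_of_nonneg (sub_nonneg.2 hr1)]
      _ ≤ 1 * (K * (D * η)) + C / dist p q * η * (2 * Real.pi * n * A) := by
          refine add_le_add (mul_le_mul hr1 h1 (abs_nonneg _) zero_le_one)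
            (mul_le_mul hr2 hYb (abs_nonneg _) (by positivity))
      _ ≤ (A + K) * ((D + C / dist p q * (2 * Real.pi * n)) * η) := by
          have e1 : 0 ≤ A * (D * η) := by positivity
          have e2 : 0 ≤ K * (C / dist p q * (2 * Real.pi * n) * η) := mul_nonneg hK hextra
          linarith
  · have e2 : 0 ≤ K * (C / dist p q * (2 * Real.pi * n) * η) := mul_nonneg hK hextra
    linarith

/-- Atoms at the same point can be merged. -/
theorem exists_strictMono_atoms {L : ℝ} {n : ℕ} (x : Fin n → Icc (0 : ℝ) L) (c : Fin n → ℤ) :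
    ∃ (N : ℕ) (x' : Fin N → Icc (0 : ℝ) L) (c' : Fin N → ℤ), StrictMono x' ∧
      ∀ f : Icc (0 : ℝ) L → ℝ, ∑ j, (c' j : ℝ) * f (x' j) = ∑ j, (c j : ℝ) * f (x j) := by
  classical
  set S : Finset (Icc (0 : ℝ) L) := Finset.univ.image x
  refine ⟨S.card, S.orderEmbOfFin rfl,
    fun i => ∑ j with x j = S.orderEmbOfFin rfl i, c j, (S.orderEmbOfFin rfl).strictMono,
    fun f => ?_⟩
  have h1 := Finset.sum_map Finset.univ (S.orderEmbOfFin rfl).toEmbedding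
    fun y => ((∑ j with x j = y, c j : ℤ) : ℝ) * f y
  rw [Finset.map_orderEmbOfFin_univ] at h1
  refine h1.symm.trans ?_
  rw [← Finset.sum_fiberwise_of_maps_to (t := S) (g := x)
    (fun j _ => Finset.mem_image_of_mem x (Finset.mem_univ j))]
  refine Finset.sum_congr rfl fun y _ => ?_
  push_cast
  rw [Finset.sum_mul]
  refine Finset.sum_congr rfl fun j hj => ?_
  rw [(Finset.mem_filter.1 hj).2]

/-- A test function which takes the sign of `c j` at `x j`. -/
theorem exists_isTest_sign {L : ℝ} {N : ℕ} {x : Fin N → Icc (0 : ℝ) L}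
    (hx : Function.Injective x) (c : Fin N → ℤ) :
    ∃ (K : ℝ) (φ : Icc (0 : ℝ) L → ℝ), IsTest 1 K φ ∧
      ∀ j, (c j : ℝ) * φ (x j) = |(c j : ℝ)| := by
  classical
  set s : Fin N → ℝ := fun j => if 0 ≤ c j then 1 else -1 with hs
  have hs1 : ∀ j, |s j| ≤ 1 := fun j => by
    simp only [hs]
    split_ifs <;> simp
  have hsc : ∀ j, (c j : ℝ) * s j = |(c j : ℝ)| := fun j => by
    simp only [hs]
    split_ifs with h
    · rw [mul_one, abs_of_nonneg (by exact_mod_cast h)]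
    · rw [mul_neg_one, abs_of_neg (by exact_mod_cast not_le.1 h)]
  set K : ℝ := ∑ i, ∑ j, 2 / dist (x i) (x j) with hK
  have hK0 : 0 ≤ K := Finset.sum_nonneg fun i _ => Finset.sum_nonneg fun j _ => by positivity
  set f : Icc (0 : ℝ) L → ℝ := Function.extend x s 0 with hf
  have hfx : ∀ j, f (x j) = s j := fun j => hx.extend_apply s 0 j
  have hlip : LipschitzOnWith K.toNNReal f (range x) := by
    refine LipschitzOnWith.of_dist_le_mul ?_
    rintro _ ⟨i, rfl⟩ _ ⟨j, rfl⟩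
    rw [hfx, hfx, Real.coe_toNNReal _ hK0]
    rcases eq_or_ne i j with rfl | hij
    · simp
    have hd : 0 < dist (x i) (x j) := dist_pos.2 fun h => hij (hx h)
    have h1 : 2 / dist (x i) (x j) ≤ K := by
      refine (Finset.single_le_sum (f := fun j => 2 / dist (x i) (x j))
        (fun j _ => by positivity) (Finset.mem_univ j)).trans ?_
      exact Finset.single_le_sum (f := fun i => ∑ j, 2 / dist (x i) (x j))
        (fun i _ => Finset.sum_nonneg fun j _ => by positivity) (Finset.mem_univ i)
    calc dist (s i) (s j) ≤ 2 := by
          rw [Real.dist_eq]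
          linarith [abs_sub (s i) (s j), hs1 i, hs1 j]
      _ = 2 / dist (x i) (x j) * dist (x i) (x j) := by field_simp
      _ ≤ K * dist (x i) (x j) := mul_le_mul_of_nonneg_right h1 hd.le
  obtain ⟨g, hg, hfg⟩ := hlip.extend_real
  have hφ := (hg.const_min 1).const_max (-1)
  refine ⟨K, fun y => max (-1) (min 1 (g y)), ⟨zero_le_one, hK0, fun y => ?_, fun y z => ?_⟩,
    fun j => ?_⟩
  · exact abs_le.2 ⟨le_max_left _ _, max_le (by norm_num) (min_le_left _ _)⟩
  · have := hφ.dist_le_mul y z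
    rwa [Real.coe_toNNReal _ hK0] at this
  · have h1 := abs_le.1 (hs1 j)
    beta_reduce
    rw [← hfg ⟨j, rfl⟩, hfx, min_eq_right h1.2, max_eq_right h1.1, hsc]

/-! ### Compactness and lower bound -/

/-- Compactness, together with the lower bound of the energy along the subsequence. -/
theorem exists_subseq_tendsto {p q : Plane} (hp : p 1 = 0) (hq : q 1 = 0) (hpq : p ≠ q)
    {ε : ℕ → ℝ} {Υ : ℕ → ℝ → Plane} {κ : ℕ → ℝ → ℝ} (hε : Tendsto ε atTop (𝓝[>] 0))
    (h : ∀ n, IsAdmissible p q (Υ n) (κ n)) {C : ℝ}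
    (hC : ∀ n, energy p q (ε n) (Υ n) (κ n) ≤ C) :
    ∃ (k : ℕ → ℕ) (N : ℕ) (x : Fin N → Icc (0 : ℝ) (dist p q)) (c : Fin N → ℤ),
      StrictMono k ∧ StrictMono x ∧
      PairTendsto (fun n => Υ (k n)) (fun n => densityMeasure (dist p q) (κ (k n))) atTop
        (segmentCurve p q) (atomicMeasure x c) ∧
      8 * √2 * ∑ j, |(c j : ℝ)| ≤ C := by
  obtain ⟨n, D, hD, key⟩ := exists_atoms_of_isAdmissible hp hq hpq (le_max_right C 0)
  have hpos : ∀ᶠ i in atTop, ε i ∈ Ioc (0 : ℝ) 1 := hε (Ioc_mem_nhdsGT zero_lt_one)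
  have hex : ∀ i, ∃ (x : Fin n → Icc (0 : ℝ) (dist p q)) (c : Fin n → ℤ), (∀ j, |c j| ≤ 1) ∧
      (ε i ∈ Ioc (0 : ℝ) 1 → ∀ (A K : ℝ) (φ : Icc (0 : ℝ) (dist p q) → ℝ), IsTest A K φ →
          |(∫ᵛ x, φ x ∂•(densityMeasure (dist p q) (κ i))) -
              2 * Real.pi * ∑ j, (c j : ℝ) * φ (x j)| ≤ (A + K) * (D * √(√(ε i))) ∧
          8 * √2 * ∑ j, (c j : ℝ) * φ (x j) ≤
            A * energy p q (ε i) (Υ i) (κ i) + K * (D * √(√(ε i)))) := fun i => by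
    by_cases hi : ε i ∈ Ioc (0 : ℝ) 1
    · obtain ⟨x, c, hc, hxc⟩ := key (ε i) (Υ i) (κ i) hi (h i) ((hC i).trans (le_max_left _ _))
      exact ⟨x, c, hc, fun _ => hxc⟩
    · exact ⟨fun _ => ⟨0, le_rfl, dist_nonneg⟩, fun _ => 0, by simp, fun hi' => absurd hi' hi⟩
  choose x c hc hxc using hex
  have hcpt : IsCompact ((univ : Set (Fin n → Icc (0 : ℝ) (dist p q))) ×ˢ
      (univ.pi fun _ : Fin n => (Icc (-1) 1 : Set ℤ))) :=
    isCompact_univ.prod (isCompact_univ_pi fun _ => (Set.finite_Icc _ _).isCompact)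
  obtain ⟨⟨x₀, c₀⟩, -, k, hk, hlim⟩ := hcpt.tendsto_subseq (x := fun i => (x i, c i))
    fun i => ⟨mem_univ _, fun j _ => abs_le.1 (hc i j)⟩
  rw [nhds_prod_eq, tendsto_prod_iff'] at hlim
  have hx₀ : ∀ j, Tendsto (fun i => x (k i) j) atTop (𝓝 (x₀ j)) := tendsto_pi_nhds.1 hlim.1
  have hc₀ : ∀ j, Tendsto (fun i => (c (k i) j : ℝ)) atTop (𝓝 (c₀ j : ℝ)) := fun j =>
    ((continuous_of_discreteTopology (f := ((↑) : ℤ → ℝ))).tendsto (c₀ j)).comp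
      (tendsto_pi_nhds.1 hlim.2 j)
  have hεk : Tendsto (fun i => ε (k i)) atTop (𝓝[>] 0) := hε.comp hk.tendsto_atTop
  have hposk : ∀ᶠ i in atTop, ε (k i) ∈ Ioc (0 : ℝ) 1 := hk.tendsto_atTop.eventually hpos
  have hη : Tendsto (fun i => √(√(ε (k i)))) atTop (𝓝 0) := by
    have := ((Real.continuous_sqrt.comp Real.continuous_sqrt).tendsto 0).comp
      (tendsto_nhdsWithin_iff.1 hεk).1
    simpa using! this
  obtain ⟨N, y, d, hy, hyd⟩ := exists_strictMono_atoms x₀ c₀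
  refine ⟨k, N, y, d, hk, hy, ?_, ?_⟩
  · obtain ⟨h1, h2⟩ := tendsto_curves hp hq hpq (fun i => h (k i))
      (tendsto_length hp hq hpq (fun i => h (k i)) hεk (Eventually.of_forall fun i => hC (k i)))
      (Υ₀ := segmentCurve p q) (fun _ _ => rfl)
    refine ⟨h1, h2, ?_⟩
    have hδ : Tendsto (fun i => D * √(√(ε (k i))) + 2 * Real.pi * ∑ j,
        (|(c (k i) j : ℝ) - c₀ j| + |(c₀ j : ℝ)| * dist (x (k i) j) (x₀ j))) atTop (𝓝 0) := by
      have e : D * 0 + 2 * Real.pi * ∑ j : Fin n,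
          (|(c₀ j : ℝ) - c₀ j| + |(c₀ j : ℝ)| * dist (x₀ j) (x₀ j)) = 0 := by simp
      rw [← congrArg 𝓝 e]
      exact (hη.const_mul D).add (Tendsto.const_mul _ (tendsto_finsetSum _ fun j _ =>
        ((hc₀ j).sub_const _).abs.add (((hx₀ j).dist tendsto_const_nhds).const_mul _)))
    refine tendsto_flatNorm_of_le hδ (hposk.mono fun i hi A K φ hφ hAK => ?_)
    rw [integral_atomicMeasure hφ, hyd]
    have hA := hφ.nonneg_bound
    have hK := hφ.nonneg_lip
    have h3 := (abs_le.1 (hxc (k i) hi A K φ hφ).1).2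
    have h4 : (A + K) * (D * √(√(ε (k i)))) ≤ D * √(√(ε (k i))) :=
      mul_le_of_le_one_left (by positivity) hAK
    have h5 : ∑ j, (c (k i) j : ℝ) * φ (x (k i) j) - ∑ j, (c₀ j : ℝ) * φ (x₀ j) ≤
        ∑ j, (|(c (k i) j : ℝ) - c₀ j| + |(c₀ j : ℝ)| * dist (x (k i) j) (x₀ j)) := by
      rw [← Finset.sum_sub_distrib]
      refine Finset.sum_le_sum fun j _ => ?_
      have e : (c (k i) j : ℝ) * φ (x (k i) j) - (c₀ j : ℝ) * φ (x₀ j) =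
          ((c (k i) j : ℝ) - c₀ j) * φ (x (k i) j) +
            (c₀ j : ℝ) * (φ (x (k i) j) - φ (x₀ j)) := by ring
      rw [e]
      refine add_le_add ((le_abs_self _).trans ?_) ((le_abs_self _).trans ?_)
      · rw [abs_mul]
        exact mul_le_of_le_one_right (abs_nonneg _) ((hφ.bound _).trans (by linarith))
      · rw [abs_mul]
        refine mul_le_mul_of_nonneg_left ((hφ.lip _ _).trans ?_) (abs_nonneg _)
        exact mul_le_of_le_one_left (abs_nonneg _) (by linarith)
    have h6 := mul_le_mul_of_nonneg_left h5 Real.two_pi_pos.le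
    rw [mul_sub] at h6
    linarith
  · obtain ⟨K, φ, hφ, hφd⟩ := exists_isTest_sign hy.injective d
    have h1 : Tendsto (fun i => 8 * √2 * ∑ j, (c (k i) j : ℝ) * φ (x (k i) j)) atTop
        (𝓝 (8 * √2 * ∑ j, (c₀ j : ℝ) * φ (x₀ j))) :=
      Tendsto.const_mul _ (tendsto_finsetSum _ fun j _ => (hc₀ j).mul
        ((hφ.lipschitzWith.continuous.tendsto _).comp (hx₀ j)))
    have h2 : Tendsto (fun i => C + K * (D * √(√(ε (k i))))) atTop (𝓝 C) := by
      have := ((hη.const_mul D).const_mul K).const_add C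
      rwa [mul_zero, mul_zero, add_zero] at this
    rw [← hyd, Finset.sum_congr rfl fun j _ => hφd j] at h1
    refine le_of_tendsto_of_tendsto h1 h2 (hposk.mono fun i hi => ?_)
    have h3 := (hxc (k i) hi 1 K φ hφ).2
    rw [one_mul] at h3
    exact h3.trans (by linarith [hC (k i)])

theorem IsH1.continuousOn {F : Type*} [NormedAddCommGroup F] [NormedSpace ℝ F] {L : ℝ}
    (hL : 0 ≤ L) {f : ℝ → F} (h : IsH1 L f) : ContinuousOn f (Icc 0 L) := by
  have h1 := intervalIntegral.continuousOn_primitive_interval (f := dx L f) (μ := volume)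
    (a := 0) (b := L) (by
      rw [uIcc_of_le hL]
      exact h.1.integrable (by norm_num))
  rw [uIcc_of_le hL] at h1
  exact (continuousOn_const.add h1).congr h.2

/-- Two continuous `L²` limits of the same sequence coincide. -/
theorem eqOn_of_tendsto_eLpNorm {L : ℝ} (hL : 0 < L) {f : ℕ → ℝ → Plane} {g g' : ℝ → Plane}
    (hf : ∀ n, ContinuousOn (f n) (Icc 0 L)) (hg : ContinuousOn g (Icc 0 L))
    (hg' : ContinuousOn g' (Icc 0 L))
    (h : Tendsto (fun n => eLpNorm (fun x => f n x - g x) 2 (volume.restrict (Icc 0 L)))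
      atTop (𝓝 0))
    (h' : Tendsto (fun n => eLpNorm (fun x => f n x - g' x) 2 (volume.restrict (Icc 0 L)))
      atTop (𝓝 0)) : EqOn g g' (Icc 0 L) := by
  have hm : ∀ {u : ℝ → Plane}, ContinuousOn u (Icc 0 L) →
      AEStronglyMeasurable u (volume.restrict (Icc 0 L)) := fun hu =>
    hu.aestronglyMeasurable measurableSet_Icc
  have h1 : eLpNorm (fun x => g x - g' x) 2 (volume.restrict (Icc 0 L)) = 0 := by
    have h2 := h'.add h
    rw [add_zero] at h2
    refine le_antisymm (ge_of_tendsto' h2 fun n => ?_) zero_le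
    have e : (fun x => g x - g' x) = (fun x => f n x - g' x) - fun x => f n x - g x := by
      ext1 x
      simp
    rw [e]
    exact eLpNorm_sub_le ((hm (hf n)).sub (hm hg'))
      ((hm (hf n)).sub (hm hg)) (by norm_num)
  have h2 := (eLpNorm_eq_zero_iff (f := fun x => g x - g' x) ((hm hg).sub (hm hg'))
    (by norm_num)).1 h1
  exact Measure.eqOn_Icc_of_ae_eq volume hL.ne
    (h2.mono fun x hx => sub_eq_zero.1 hx) hg hg'

/-- The lower bound. If it fails, compactness applies to a subsequence along which the energies
stay below the claimed bound, and gives the same limit with a smaller total multiplicity. -/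
theorem lower_bound {p q : Plane} (hp : p 1 = 0) (hq : q 1 = 0) (hpq : p ≠ q)
    {ε : ℕ → ℝ} {Υ : ℕ → ℝ → Plane} {κ : ℕ → ℝ → ℝ} {Υ₀ : ℝ → Plane}
    {μ : SignedMeasure (Icc (0 : ℝ) (dist p q))} (hε : Tendsto ε atTop (𝓝[>] 0))
    (h : ∀ n, IsAdmissible p q (Υ n) (κ n)) (hΥ₀ : IsH1 (dist p q) Υ₀)
    (hlim : PairTendsto Υ (fun n => densityMeasure (dist p q) (κ n)) atTop Υ₀ μ) :
    ((8 * √2 : ℝ) : EReal) * limitEnergy p q Υ₀ μ ≤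
      liminf (fun n => ((energy p q (ε n) (Υ n) (κ n) : ℝ) : EReal)) atTop := by
  have hL : 0 < dist p q := dist_pos.2 hpq
  by_contra! hlt
  obtain ⟨e, he1, he2⟩ := EReal.lt_iff_exists_real_btwn.1 hlt
  obtain ⟨k, hk, hke⟩ := extraction_of_frequently_atTop (frequently_lt_of_liminf_lt
    (by isBoundedDefault) he1)
  obtain ⟨k', N, x, c, hk', hx, hlim', hle⟩ := exists_subseq_tendsto hp hq hpq
    (hε.comp hk.tendsto_atTop) (fun n => h (k n)) (C := e) fun n =>
      (EReal.coe_lt_coe_iff.1 (hke n)).le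
  have hkk : Tendsto (fun n => k (k' n)) atTop atTop := hk.tendsto_atTop.comp hk'.tendsto_atTop
  have hμ : μ = atomicMeasure x c := flatLimit_unique (hlim.2.2.comp hkk) hlim'.2.2
  have hcurve : EqOn Υ₀ (segmentCurve p q) (Icc 0 (dist p q)) :=
    eqOn_of_tendsto_eLpNorm hL (fun n => (h (k (k' n))).isH2.1.continuousOn hL.le)
      (hΥ₀.continuousOn hL.le)
      (fun t _ => (hasDerivAt_segmentCurve p q t).continuousAt.continuousWithinAt)
      (hlim.1.comp hkk) hlim'.1
  rw [limitEnergy_eq ⟨hcurve, hx, hμ⟩, ← EReal.coe_mul, EReal.coe_lt_coe_iff] at he2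
  linarith

/-! ### The transition profile -/

/-- The speed of the transition profile, as a function of the angle. For `η = 0` it is the optimal
profile, which needs infinite time to make a full turn. -/
noncomputable def profileSpeed (η t : ℝ) : ℝ := √(1 - Real.cos t + η ^ 2)

theorem le_profileSpeed (η t : ℝ) : η ≤ profileSpeed η t :=
  Real.le_sqrt_of_sq_le (by linarith [Real.cos_le_one t])

theorem continuous_profileSpeed (η : ℝ) : Continuous (profileSpeed η) := by
  unfold profileSpeed
  fun_prop

section Profile

variable {η : ℝ} (hη : 0 < η)
include hη

theorem profileSpeed_radicand_pos (t : ℝ) : 0 < 1 - Real.cos t + η ^ 2 := by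
  have := pow_pos hη 2
  linarith [Real.cos_le_one t]

theorem profileSpeed_sq (t : ℝ) : profileSpeed η t ^ 2 = 1 - Real.cos t + η ^ 2 :=
  Real.sq_sqrt (profileSpeed_radicand_pos hη t).le

theorem profileSpeed_pos (t : ℝ) : 0 < profileSpeed η t := hη.trans_le (le_profileSpeed η t)

theorem profileSpeed_le (t : ℝ) : profileSpeed η t ≤ √2 * |Real.sin (t / 2)| + η := by
  refine Real.sqrt_le_iff.2 ⟨by positivity, ?_⟩
  have h1 : Real.cos t = 1 - 2 * |Real.sin (t / 2)| ^ 2 := by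
    rw [sq_abs, Real.sin_sq_eq_half_sub]
    ring_nf
  have h2 : √2 ^ 2 = 2 := Real.sq_sqrt (by norm_num)
  have h3 : 0 ≤ √2 * |Real.sin (t / 2)| * η := by positivity
  rw [h1]
  nlinarith

theorem profileSpeed_le_const (t : ℝ) : profileSpeed η t ≤ √2 + η :=
  (profileSpeed_le hη t).trans (by
    have := mul_le_mul_of_nonneg_left (Real.abs_sin_le_one (t / 2)) (Real.sqrt_nonneg 2)
    linarith)

theorem hasDerivAt_profileSpeed (t : ℝ) :
    HasDerivAt (profileSpeed η) (Real.sin t / (2 * profileSpeed η t)) t := by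
  have h1 : HasDerivAt (fun t => 1 - Real.cos t + η ^ 2) (Real.sin t) t := by
    have := ((Real.hasDerivAt_cos t).const_sub 1).add_const (η ^ 2)
    rwa [neg_neg] at this
  exact h1.sqrt (profileSpeed_radicand_pos hη t).ne'

/-- The solution of `U' = profileSpeed η U / s`, as the inverse function of the time which it
needs to reach a given angle. -/
theorem exists_profile {s : ℝ} (hs : 0 < s) :
    ∃ U : ℝ → ℝ, (∀ t, HasDerivAt U (profileSpeed η (U t) / s) t) ∧ U 0 = 0 ∧
      ∀ y, 0 ≤ y → ∃ h, 0 ≤ h ∧ h ≤ y * (s / η) ∧ U h = y := by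
  have hpos := profileSpeed_pos hη
  have hcont : Continuous fun y => s / profileSpeed η y :=
    continuous_const.div (continuous_profileSpeed η) fun y => (hpos y).ne'
  set T : ℝ → ℝ := fun y => ∫ u in (0 : ℝ)..y, s / profileSpeed η u with hT
  have hTd : ∀ y, HasDerivAt T (s / profileSpeed η y) y := fun y =>
    intervalIntegral.integral_hasDerivAt_right (hcont.intervalIntegrable _ _)
      (hcont.stronglyMeasurableAtFilter _ _) hcont.continuousAt
  have hT0 : T 0 = 0 := intervalIntegral.integral_same
  have hTmono : StrictMono T := strictMono_of_hasDerivAt_pos hTd fun y => div_pos hs (hpos y)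
  set r := s / (√2 + η) with hr
  have hr0 : 0 < r := by positivity
  have hgrow : Monotone fun y => T y - r * y :=
    monotone_of_deriv_nonneg
      (fun y => ((hTd y).sub ((hasDerivAt_id y).const_mul r)).differentiableAt) fun y => by
        have := ((hTd y).sub ((hasDerivAt_id y).const_mul r)).deriv
        simp only [id_eq, mul_one] at this
        refine le_of_le_of_eq ?_ this.symm
        exact sub_nonneg.2 (div_le_div_of_nonneg_left hs.le (hpos y) (profileSpeed_le_const hη y))
  have hsurj : Function.Surjective T := by
    refine (continuous_iff_continuousAt.2 fun y => (hTd y).continuousAt).surjective ?_ ?_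
    · refine tendsto_atTop_mono' atTop ?_ (tendsto_id.const_mul_atTop hr0)
      filter_upwards [eventually_ge_atTop 0] with y hy
      have := hgrow hy
      simp only [hT0, mul_zero, sub_zero] at this
      simpa using this
    · refine tendsto_atBot_mono' atBot ?_ (tendsto_id.const_mul_atBot hr0)
      filter_upwards [eventually_le_atBot 0] with y hy
      have := hgrow hy
      simp only [hT0, mul_zero, sub_zero] at this
      simpa using this
  set e := hTmono.orderIsoOfSurjective T hsurj with he
  have heT : ∀ y, e y = T y := fun y => rfl
  refine ⟨e.symm, fun t => ?_, ?_, fun y hy => ⟨T y, ?_, ?_, ?_⟩⟩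
  · have := HasDerivAt.of_local_left_inverse (f := T) (g := e.symm) (a := t)
      e.symm.continuous.continuousAt (hTd _) (div_pos hs (hpos _)).ne'
      (Eventually.of_forall fun y => e.apply_symm_apply y)
    rwa [inv_div] at this
  · rw [e.symm_apply_eq, heT, hT0]
  · rw [← hT0]
    exact hTmono.monotone hy
  · calc T y ≤ ∫ u in (0 : ℝ)..y, s / η :=
          intervalIntegral.integral_mono_on hy (hcont.intervalIntegrable _ _)
            intervalIntegrable_const fun u _ =>
              div_le_div_of_nonneg_left hs.le hη (le_profileSpeed η u)
      _ = y * (s / η) := by rw [intervalIntegral.integral_const, sub_zero, smul_eq_mul]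
  · rw [← heT, e.symm_apply_apply]

end Profile

/-- A transition `v` from the angle `0` to the angle `2πc` which takes place in the time interval
`[0, h]`, with derivative `v'` (except at `0` and `h`). It takes at most the time `B` per turn, and
its energy with weight `s` is at most `E` per turn. -/
structure IsTransition (s B E : ℝ) (c : ℤ) (h : ℝ) (v v' : ℝ → ℝ) : Prop where
  nonneg : 0 ≤ h
  le : h ≤ |(c : ℝ)| * B
  lipschitz : ∃ K, LipschitzWith K v
  before : ∀ t, t ≤ 0 → v t = 0
  after : ∀ t, h ≤ t → v t = 2 * Real.pi * c
  hasDerivAt : ∀ t, t ≠ 0 → t ≠ h → HasDerivAt v (v' t) t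
  deriv_eq_zero : ∀ t, t ∉ Ioc 0 h → v' t = 0
  integrable : IntervalIntegrable v' volume 0 h
  integrable_sq : IntervalIntegrable (fun t => v' t ^ 2) volume 0 h
  integral_deriv : ∫ t in (0 : ℝ)..h, v' t = 2 * Real.pi * c
  integral_abs_deriv : ∫ t in (0 : ℝ)..h, |v' t| = 2 * Real.pi * |(c : ℝ)|
  integral_sin : ∫ t in (0 : ℝ)..h, Real.sin (v t) = 0
  energy_le : ∫ t in (0 : ℝ)..h, (s * v' t ^ 2 + s⁻¹ * (1 - Real.cos (v t))) ≤ |(c : ℝ)| * E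

theorem exists_isTransition {η s : ℝ} (hη : 0 < η) (hs : 0 < s) (c : ℤ) :
    ∃ (h : ℝ) (v v' : ℝ → ℝ),
      IsTransition s (2 * Real.pi * (s / η)) (8 * √2 + 4 * Real.pi * η) c h v v' := by
  obtain ⟨U, hU, hU0, hreach⟩ := exists_profile hη hs
  obtain ⟨h, h0, hle, hUh⟩ := hreach (2 * Real.pi * |(c : ℝ)|) (by positivity)
  -- the sign of the turns
  obtain ⟨σ, hσ, hσc⟩ : ∃ σ : ℝ, (σ = 1 ∨ σ = -1) ∧ σ * |(c : ℝ)| = c := by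
    rcases abs_choice (c : ℝ) with h | h
    · exact ⟨1, Or.inl rfl, by rw [h, one_mul]⟩
    · exact ⟨-1, Or.inr rfl, by rw [h, neg_one_mul, neg_neg]⟩
  have hσ2 : σ ^ 2 = 1 := by rcases hσ with rfl | rfl <;> norm_num
  have hσa : |σ| = 1 := by rcases hσ with rfl | rfl <;> norm_num
  have hpos := profileSpeed_pos hη
  have hUc : Continuous U := continuous_iff_continuousAt.2 fun t => (hU t).continuousAt
  have hWc : Continuous fun t => profileSpeed η (U t) := (continuous_profileSpeed η).comp hUc
  have hUlip : LipschitzWith ((√2 + η) / s).toNNReal U :=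
    lipschitzWith_of_nnnorm_deriv_le (fun t => (hU t).differentiableAt) fun t => by
      rw [(hU t).deriv, ← NNReal.coe_le_coe, Real.coe_toNNReal _ (by positivity), coe_nnnorm,
        Real.norm_eq_abs, abs_of_pos (div_pos (hpos _) hs)]
      exact div_le_div_of_nonneg_right (profileSpeed_le_const hη _) hs.le
  set v : ℝ → ℝ := fun t => σ * U (max 0 (min h t)) with hv
  set v' : ℝ → ℝ := fun t => (Ioc 0 h).indicator (fun t => σ * (profileSpeed η (U t) / s)) t
    with hv'
  have hvIcc : ∀ t ∈ Icc 0 h, v t = σ * U t := fun t ht => by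
    simp only [hv]
    rw [min_eq_right ht.2, max_eq_right ht.1]
  have hv'Ioc : ∀ t ∈ Ioc 0 h, v' t = σ * (profileSpeed η (U t) / s) := fun t ht =>
    indicator_of_mem ht _
  have hv'c : Continuous fun t => σ * (profileSpeed η (U t) / s) := by fun_prop
  have hbefore : ∀ t, t ≤ 0 → v t = 0 := fun t ht => by
    simp only [hv]
    rw [max_eq_left ((min_le_right _ _).trans ht), hU0, mul_zero]
  have hafter : ∀ t, h ≤ t → v t = 2 * Real.pi * c := fun t ht => by
    simp only [hv]
    rw [min_eq_left ht, max_eq_right h0, hUh]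
    linear_combination (2 * Real.pi) * hσc
  have hcongr : ∀ (F : ℝ → ℝ → ℝ), ∫ t in (0 : ℝ)..h, F (v' t) (v t) =
      ∫ t in (0 : ℝ)..h, F (σ * (profileSpeed η (U t) / s)) (σ * U t) := fun F => by
    refine intervalIntegral.integral_congr_ae (Eventually.of_forall fun t ht => ?_)
    rw [uIoc_of_le h0] at ht
    rw [hv'Ioc t ht, hvIcc t ⟨ht.1.le, ht.2⟩]
  have hint : ∀ F : ℝ → ℝ, Continuous F → IntervalIntegrable (fun t => F (v' t)) volume 0 h :=
    fun F hF => by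
      refine ((hF.comp hv'c).intervalIntegrable 0 h).congr fun t ht => ?_
      rw [uIoc_of_le h0] at ht
      simp only [Function.comp_apply, hv'Ioc t ht]
  have hUint : ∫ t in (0 : ℝ)..h, profileSpeed η (U t) / s = 2 * Real.pi * |(c : ℝ)| := by
    rw [intervalIntegral.integral_eq_sub_of_hasDerivAt (fun t _ => hU t)
      ((hWc.div_const s).intervalIntegrable _ _), hUh, hU0, sub_zero]
  refine ⟨h, v, v', h0, hle.trans (le_of_eq (by ring)), ?_, hbefore, hafter, fun t ht0 hth => ?_,
    fun t ht => indicator_of_notMem ht _, hint id continuous_id, hint (· ^ 2) (by fun_prop),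
    ?_, ?_, ?_, ?_⟩
  · have h1 : LipschitzWith 1 fun t => max 0 (min h t) :=
      (LipschitzWith.id.const_min h).const_max 0
    refine ⟨_, LipschitzWith.of_dist_le_mul (K := ((√2 + η) / s).toNNReal) fun t u => ?_⟩
    have h2 := (hUlip.comp h1).dist_le_mul t u
    rw [mul_one] at h2
    simp only [hv, Real.dist_eq, ← mul_sub, abs_mul, hσa, one_mul]
    exact h2
  · rcases lt_or_gt_of_ne ht0 with h1 | h1
    · rw [show v' t = 0 from indicator_of_notMem (fun hm => absurd hm.1 (not_lt.2 h1.le)) _]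
      refine (hasDerivAt_const t (0 : ℝ)).congr_of_eventuallyEq ?_
      filter_upwards [Iio_mem_nhds h1] with u hu using hbefore u hu.le
    · rcases lt_or_gt_of_ne hth with h2 | h2
      · rw [hv'Ioc t ⟨h1, h2.le⟩]
        refine ((hU t).const_mul σ).congr_of_eventuallyEq ?_
        filter_upwards [Icc_mem_nhds h1 h2] with u hu using hvIcc u hu
      · rw [show v' t = 0 from indicator_of_notMem (fun hm => absurd hm.2 (not_le.2 h2)) _]
        refine (hasDerivAt_const t (2 * Real.pi * c : ℝ)).congr_of_eventuallyEq ?_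
        filter_upwards [Ioi_mem_nhds h2] with u hu using hafter u hu.le
  · rw [hcongr fun a _ => a, intervalIntegral.integral_const_mul, hUint]
    linear_combination (2 * Real.pi) * hσc
  · rw [hcongr fun a _ => |a|, ← hUint]
    refine intervalIntegral.integral_congr fun t _ => ?_
    rw [abs_mul, hσa, one_mul, abs_of_pos (div_pos (hpos _) hs)]
  · -- By the pendulum equation, `sin U` is the derivative of `2 s * profileSpeed η U`.
    rw [hcongr fun _ b => Real.sin b]
    have e : ∀ t, Real.sin (σ * U t) = σ * Real.sin (U t) := fun t => by
      rcases hσ with rfl | rfl <;> simp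
    simp_rw [e]
    have hd : ∀ t, HasDerivAt (fun t => 2 * s * profileSpeed η (U t)) (Real.sin (U t)) t :=
      fun t => by
        refine (((hasDerivAt_profileSpeed hη (U t)).comp t (hU t)).const_mul
          (2 * s)).congr_deriv ?_
        have := (hpos (U t)).ne'
        field_simp
    rw [intervalIntegral.integral_const_mul, intervalIntegral.integral_eq_sub_of_hasDerivAt
      (fun t _ => hd t) ((Real.continuous_sin.comp hUc).intervalIntegrable _ _), hUh, hU0]
    have hcos : Real.cos (2 * Real.pi * |(c : ℝ)|) = Real.cos 0 := by
      rw [mul_comm, ← Int.cast_abs, Real.cos_int_mul_two_pi, Real.cos_zero]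
    simp only [profileSpeed, hcos, sub_self, mul_zero]
  · rw [hcongr fun a b => s * a ^ 2 + s⁻¹ * (1 - Real.cos b)]
    have hd : ∀ t, HasDerivAt (fun t => 2 * √2 * angleCost (U t) + 2 * η * U t)
        (2 * (√2 * |Real.sin (U t / 2)| + η) * (profileSpeed η (U t) / s)) t := fun t => by
      refine ((((hasDerivAt_angleCost (U t)).comp t (hU t)).const_mul (2 * √2)).add
        ((hU t).const_mul (2 * η))).congr_deriv ?_
      ring
    have hdc : Continuous fun t =>
        2 * (√2 * |Real.sin (U t / 2)| + η) * (profileSpeed η (U t) / s) := by fun_prop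
    calc _ ≤ ∫ t in (0 : ℝ)..h,
          2 * (√2 * |Real.sin (U t / 2)| + η) * (profileSpeed η (U t) / s) := by
          refine intervalIntegral.integral_mono_on h0 ?_ (hdc.intervalIntegrable _ _)
            fun t _ => ?_
          · exact (by fun_prop : Continuous _).intervalIntegrable _ _
          · have h1 : Real.cos (σ * U t) = Real.cos (U t) := by
              rcases hσ with rfl | rfl <;> simp
            have h2 := profileSpeed_sq hη (U t)
            have h3 := profileSpeed_le hη (U t)
            set W := profileSpeed η (U t)
            rw [h1, show 1 - Real.cos (U t) = W ^ 2 - η ^ 2 by linarith]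
            calc s * (σ * (W / s)) ^ 2 + s⁻¹ * (W ^ 2 - η ^ 2)
                = (2 * W * W - η ^ 2) / s := by
                  rw [mul_pow, hσ2]
                  field_simp
                  ring
              _ ≤ 2 * (√2 * |Real.sin (U t / 2)| + η) * W / s := by
                  refine div_le_div_of_nonneg_right ?_ hs.le
                  have := mul_le_mul_of_nonneg_right h3 (hpos (U t)).le
                  nlinarith [sq_nonneg η]
              _ = _ := by ring
      _ = |(c : ℝ)| * (8 * √2 + 4 * Real.pi * η) := by
          rw [intervalIntegral.integral_eq_sub_of_hasDerivAt (fun t _ => hd t)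
            (hdc.intervalIntegrable _ _), hUh, hU0, ← Int.cast_abs, angleCost_int, angleCost_zero]
          ring

/-! ### Angles with several transitions -/

/-- A `2π`-periodic function which vanishes at `0` is additive on families of angles of which all
but at most one are full turns. -/
theorem periodic_sum {ι : Type*} {F : ℝ → ℝ}
    (hF : ∀ (t : ℝ) (k : ℤ), F (t + k * (2 * Real.pi)) = F t) (h0 : F 0 = 0)
    (S : Finset ι) {t : ι → ℝ}
    (ht : ∀ i j, i ≠ j → (∃ k : ℤ, t i = k * (2 * Real.pi)) ∨ ∃ k : ℤ, t j = k * (2 * Real.pi)) :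
    F (∑ i ∈ S, t i) = ∑ i ∈ S, F (t i) := by
  classical
  have hturn : ∀ k : ℤ, F (k * (2 * Real.pi)) = 0 := fun k => by
    rw [← zero_add ((k : ℝ) * _), hF, h0]
  induction S using Finset.induction_on with
  | empty => simpa using h0
  | insert a S ha ih =>
    rw [Finset.sum_insert ha, Finset.sum_insert ha, ← ih]
    by_cases hk : ∃ k : ℤ, t a = k * (2 * Real.pi)
    · obtain ⟨k, hk⟩ := hk
      rw [hk, add_comm, hF, hturn, zero_add]
    · have hex : ∀ i ∈ S, ∃ k : ℤ, t i = k * (2 * Real.pi) := fun i hi =>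
        (ht a i fun h => ha (h ▸ hi)).resolve_left hk
      obtain ⟨k, hk'⟩ : ∃ k : ℤ, ∑ i ∈ S, t i = k * (2 * Real.pi) := by
        choose! k hk using hex
        exact ⟨∑ i ∈ S, k i, by rw [Finset.sum_congr rfl hk, ← Finset.sum_mul, Int.cast_sum]⟩
      rw [hk', hF, hturn, add_zero]

theorem sq_sum_eq {ι : Type*} (S : Finset ι) {d : ι → ℝ}
    (hd : ∀ i j, i ≠ j → d i = 0 ∨ d j = 0) : (∑ i ∈ S, d i) ^ 2 = ∑ i ∈ S, d i ^ 2 := by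
  classical
  induction S using Finset.induction_on with
  | empty => simp
  | insert a S ha ih =>
    rw [Finset.sum_insert ha, Finset.sum_insert ha, ← ih]
    have h0 : d a * ∑ i ∈ S, d i = 0 := by
      rw [Finset.mul_sum]
      refine Finset.sum_eq_zero fun i hi => mul_eq_zero.2 (hd a i fun h => ha (h ▸ hi))
    linear_combination 2 * h0

theorem integral_comp_sub_of_support {f : ℝ → ℝ} {a h L : ℝ} (ha : 0 ≤ a)
    (haL : a + h ≤ L) (hf : ∀ t, t ∉ Ioc 0 h → f t = 0) :
    ∫ x in (0 : ℝ)..L, f (x - a) = ∫ t in (0 : ℝ)..h, f t := by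
  have hs : Function.support f ⊆ Ioc 0 h := fun t ht => by
    by_contra hn
    exact ht (hf t hn)
  rw [intervalIntegral.integral_comp_sub_right,
    intervalIntegral.integral_eq_integral_of_support_subset hs,
    intervalIntegral.integral_eq_integral_of_support_subset
      (hs.trans (Ioc_subset_Ioc (by linarith) (by linarith)))]

theorem intervalIntegrable_comp_sub_of_support {f : ℝ → ℝ} {a h L : ℝ} (h0 : 0 ≤ h)
    (hf : ∀ t, t ∉ Ioc 0 h → f t = 0) (hi : IntervalIntegrable f volume 0 h) :
    IntervalIntegrable (fun x => f (x - a)) volume 0 L := by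
  have h1 : Integrable f := by
    rw [intervalIntegrable_iff_integrableOn_Ioc_of_le h0] at hi
    exact (integrableOn_iff_integrable_of_support_subset fun t ht => by
      by_contra hn
      exact ht (hf t hn)).1 hi
  exact (h1.comp_sub_right a).intervalIntegrable

/-- An angle which makes `c j` turns close to `x j` and satisfies the closing condition
`∫ sin ψ = 0`, with the energy estimated by the one of the single transitions. -/
theorem exists_recovery_angle {L η s : ℝ} (hη : 0 < η) (hs : 0 < s) {N : ℕ}
    {x : Fin N → Icc (0 : ℝ) L} (hx : Monotone x) (c : Fin N → ℤ) {w : ℝ}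
    (hw : ∀ j, |(c j : ℝ)| * (2 * Real.pi * (s / η)) < w) (hwL : N * w ≤ L) (hL : 0 < L) :
    ∃ ψ : ℝ → ℝ, (∃ K, LipschitzWith K ψ) ∧ ψ 0 = 0 ∧ (∃ k : ℤ, ψ L = 2 * Real.pi * k) ∧
      ∫ t in (0 : ℝ)..L, Real.sin (ψ t) = 0 ∧
      ∫ t in (0 : ℝ)..L, (s * deriv ψ t ^ 2 + s⁻¹ * (1 - Real.cos (ψ t))) ≤
        (∑ j, |(c j : ℝ)|) * (8 * √2 + 4 * Real.pi * η) ∧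
      ∀ (A K : ℝ) (φ : Icc (0 : ℝ) L → ℝ), IsTest A K φ →
        |(∫ t in (0 : ℝ)..L, IccExtend hL.le φ t * deriv ψ t) -
          2 * Real.pi * ∑ j, (c j : ℝ) * φ (x j)| ≤
          K * ((N + 1) * w * (2 * Real.pi * ∑ j, |(c j : ℝ)|)) := by
  have hpi := Real.pi_pos
  choose h v v' hv using fun j => exists_isTransition hη hs (c j)
  have hhw : ∀ j, h j < w := fun j => (hv j).le.trans_lt (hw j)
  -- The `j`-th window starts at `a j`. It has length `w`, the windows are disjoint and contained
  -- in `[0, L]`.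
  set r : ℝ := 1 - N * w / L with hr
  have hr0 : 0 ≤ r := sub_nonneg.2 ((div_le_one hL).2 hwL)
  set a : Fin N → ℝ := fun j => (x j : ℝ) * r + j * w with ha
  have hw0 : ∀ _ : Fin N, 0 < w := fun j => (hv j).nonneg.trans_lt (hhw j)
  have ha0 : ∀ j, 0 ≤ a j := fun j =>
    add_nonneg (mul_nonneg (x j).2.1 hr0) (mul_nonneg (Nat.cast_nonneg _) (hw0 j).le)
  have haL : ∀ j, a j + w ≤ L := fun j => by
    have h1 : (x j : ℝ) * r ≤ L * r := mul_le_mul_of_nonneg_right (x j).2.2 hr0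
    have h2 : L * r = L - N * w := by
      rw [hr]
      field_simp
    have h3 : ((j : ℕ) : ℝ) + 1 ≤ N := by exact_mod_cast j.2
    have h4 := mul_le_mul_of_nonneg_right h3 (hw0 j).le
    simp only [ha]
    linarith
  have hahL : ∀ j, a j + h j ≤ L := fun j => by linarith [haL j, hhw j]
  have hax : ∀ j, |a j - x j| ≤ N * w := fun j => by
    have hxw : (x j : ℝ) * (N * w / L) ≤ N * w := by
      rw [mul_div_assoc', div_le_iff₀ hL, mul_comm (x j : ℝ)]
      exact mul_le_mul_of_nonneg_left (x j).2.2 (mul_nonneg (Nat.cast_nonneg _) (hw0 j).le)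
    have hxw0 : 0 ≤ (x j : ℝ) * (N * w / L) := mul_nonneg (x j).2.1
      (div_nonneg (mul_nonneg (Nat.cast_nonneg _) (hw0 j).le) hL.le)
    have hjw : ((j : ℕ) : ℝ) * w ≤ N * w :=
      mul_le_mul_of_nonneg_right (by exact_mod_cast j.2.le) (hw0 j).le
    have hjw0 : 0 ≤ ((j : ℕ) : ℝ) * w := mul_nonneg (Nat.cast_nonneg _) (hw0 j).le
    have e : a j - x j = j * w - (x j : ℝ) * (N * w / L) := by
      simp only [ha, hr]
      ring
    rw [e, abs_le]
    constructor <;> linarith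
  have hdisj : ∀ (y : ℝ) (i j : Fin N), i ≠ j →
      y - a i ∉ Ioc 0 (h i) ∨ y - a j ∉ Ioc 0 (h j) := fun y => by
    have key : ∀ i j : Fin N, i < j → y - a i ∈ Ioc 0 (h i) → y - a j ∉ Ioc 0 (h j) :=
      fun i j hij hi hj => by
        have h1 : (x i : ℝ) * r ≤ x j * r := mul_le_mul_of_nonneg_right (hx hij.le) hr0
        have h2 : ((i : ℕ) : ℝ) + 1 ≤ (j : ℕ) := by exact_mod_cast hij
        have h3 := mul_le_mul_of_nonneg_right h2 (hw0 i).le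
        have h4 := hi.2
        have h5 := hj.1
        have h6 := hhw i
        simp only [ha] at h4 h5
        linarith
    intro i j hij
    rcases lt_or_gt_of_ne hij with h1 | h1
    · exact or_iff_not_imp_left.2 fun h2 => key i j h1 (not_not.1 h2)
    · exact or_iff_not_imp_right.2 fun h2 => key j i h1 (not_not.1 h2)
  have hturn : ∀ j t, t ∉ Ioc 0 (h j) → ∃ k : ℤ, v j t = k * (2 * Real.pi) := fun j t ht => by
    rcases le_or_gt t 0 with h1 | h1
    · exact ⟨0, by rw [(hv j).before t h1]; simp⟩
    · have h2 : h j ≤ t := by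
        by_contra! h2
        exact ht ⟨h1, h2.le⟩
      exact ⟨c j, by rw [(hv j).after t h2]; ring⟩
  set ψ : ℝ → ℝ := fun y => ∑ j, v j (y - a j) with hψ
  have hvc : ∀ j, Continuous (v j) := fun j => (hv j).lipschitz.choose_spec.continuous
  -- Away from the ends of the windows the angle is differentiable.
  have hderiv : ∀ᵐ y, deriv ψ y = ∑ j, v' j (y - a j) := by
    have h1 : ∀ᵐ y, y ∉ range a := (finite_range a).countable.ae_notMem _
    have h2 : ∀ᵐ y, y ∉ range fun j => a j + h j := (finite_range _).countable.ae_notMem _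
    filter_upwards [h1, h2] with y hy1 hy2
    refine (HasDerivAt.fun_sum fun j _ => HasDerivAt.comp_sub_const y (a j)
      ((hv j).hasDerivAt _ (fun h3 => hy1 ⟨j, by linarith⟩)
        fun h3 => hy2 ⟨j, by simp only; linarith⟩)).deriv
  have hsum : ∀ F : ℝ → ℝ, (∀ (t : ℝ) (k : ℤ), F (t + k * (2 * Real.pi)) = F t) →
      F 0 = 0 → ∀ y, F (ψ y) = ∑ j, F (v j (y - a j)) := fun F hF hF0 y =>
    periodic_sum hF hF0 _ fun i j hij => (hdisj y i j hij).imp (hturn i _) (hturn j _)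
  have hzero : ∀ F : ℝ → ℝ, (∀ (t : ℝ) (k : ℤ), F (t + k * (2 * Real.pi)) = F t) → F 0 = 0 →
      ∀ j t, t ∉ Ioc 0 (h j) → F (v j t) = 0 := fun F hF hF0 j t ht => by
    obtain ⟨k, hk⟩ := hturn j t ht
    rw [hk, ← zero_add ((k : ℝ) * _), hF, hF0]
  refine ⟨ψ, ?_, ?_, ?_, ?_, ?_, fun A K φ hφ => ?_⟩
  · choose K hK using fun j => (hv j).lipschitz
    refine ⟨∑ j, K j, LipschitzWith.of_dist_le_mul fun y z => ?_⟩
    rw [NNReal.coe_sum, Finset.sum_mul]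
    refine (dist_sum_sum_le _ _ _).trans (Finset.sum_le_sum fun j _ => ?_)
    simpa using (hK j).dist_le_mul (y - a j) (z - a j)
  · exact Finset.sum_eq_zero fun j _ => (hv j).before _ (by linarith [ha0 j])
  · refine ⟨∑ j, c j, ?_⟩
    rw [Int.cast_sum, Finset.mul_sum]
    exact Finset.sum_congr rfl fun j _ => (hv j).after _ (by linarith [hahL j])
  · have hp := fun (t : ℝ) (k : ℤ) => Real.sin_add_int_mul_two_pi t k
    simp_rw [hsum Real.sin hp Real.sin_zero]
    have hi : ∀ j ∈ Finset.univ,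
        IntervalIntegrable (fun y => Real.sin (v j (y - a j))) volume 0 L := fun j _ =>
      (by fun_prop : Continuous fun y => Real.sin (v j (y - a j))).intervalIntegrable _ _
    rw [intervalIntegral.integral_finsetSum hi]
    refine Finset.sum_eq_zero fun j _ => ?_
    rw [integral_comp_sub_of_support (f := fun t => Real.sin (v j t)) (ha0 j) (hahL j)
      (hzero _ hp Real.sin_zero j), (hv j).integral_sin]
  · have hp : ∀ (t : ℝ) (k : ℤ), 1 - Real.cos (t + k * (2 * Real.pi)) = 1 - Real.cos t :=
      fun t k => by rw [Real.cos_add_int_mul_two_pi]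
    have hp0 : 1 - Real.cos 0 = 0 := by simp
    have e : ∀ᵐ y, s * deriv ψ y ^ 2 + s⁻¹ * (1 - Real.cos (ψ y)) =
        ∑ j, (s * v' j (y - a j) ^ 2 + s⁻¹ * (1 - Real.cos (v j (y - a j)))) := by
      filter_upwards [hderiv] with y hy
      rw [hy, sq_sum_eq _ fun i j hij => (hdisj y i j hij).imp ((hv i).deriv_eq_zero _)
        ((hv j).deriv_eq_zero _), hsum (fun t => 1 - Real.cos t) hp hp0 y,
        Finset.mul_sum, Finset.mul_sum, Finset.sum_add_distrib]
    have hz : ∀ j t, t ∉ Ioc 0 (h j) → s * v' j t ^ 2 + s⁻¹ * (1 - Real.cos (v j t)) = 0 :=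
      fun j t ht => by
        rw [(hv j).deriv_eq_zero t ht, hzero (fun t => 1 - Real.cos t) hp hp0 j t ht]
        ring
    have hi : ∀ j, IntervalIntegrable (fun t => s * v' j t ^ 2 + s⁻¹ * (1 - Real.cos (v j t)))
        volume 0 (h j) := fun j => ((hv j).integrable_sq.const_mul s).add
      ((by fun_prop : Continuous fun t => s⁻¹ * (1 - Real.cos (v j t))).intervalIntegrable _ _)
    rw [intervalIntegral.integral_congr_ae (e.mono fun y hy _ => hy),
      intervalIntegral.integral_finsetSum fun j _ =>
        intervalIntegrable_comp_sub_of_support (hv j).nonneg (hz j) (hi j), Finset.sum_mul]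
    refine Finset.sum_le_sum fun j _ => ?_
    rw [integral_comp_sub_of_support
      (f := fun t => s * v' j t ^ 2 + s⁻¹ * (1 - Real.cos (v j t))) (ha0 j) (hahL j) (hz j)]
    exact (hv j).energy_le
  · have hφc : Continuous (IccExtend hL.le φ) := (hφ.lipschitzWith_extend hL.le).continuous
    have hlip : ∀ y z, |IccExtend hL.le φ y - IccExtend hL.le φ z| ≤ K * |y - z| := fun y z => by
      have := (hφ.lipschitzWith_extend hL.le).dist_le_mul y z
      rwa [Real.coe_toNNReal _ hφ.nonneg_lip] at this
    have e : ∀ᵐ y, IccExtend hL.le φ y * deriv ψ y =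
        ∑ j, IccExtend hL.le φ (y - a j + a j) * v' j (y - a j) := by
      filter_upwards [hderiv] with y hy
      rw [hy, Finset.mul_sum]
      simp only [sub_add_cancel]
    have hz : ∀ j t, t ∉ Ioc 0 (h j) → IccExtend hL.le φ (t + a j) * v' j t = 0 :=
      fun j t ht => by rw [(hv j).deriv_eq_zero t ht, mul_zero]
    have hi : ∀ j, IntervalIntegrable (fun t => IccExtend hL.le φ (t + a j) * v' j t)
        volume 0 (h j) := fun j => (hv j).integrable.continuousOn_mul (by fun_prop)
    rw [intervalIntegral.integral_congr_ae (e.mono fun y hy _ => hy),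
      intervalIntegral.integral_finsetSum fun j _ =>
        intervalIntegrable_comp_sub_of_support (f := fun t => IccExtend hL.le φ (t + a j) * v' j t)
          (hv j).nonneg (hz j) (hi j), Finset.mul_sum, ← Finset.sum_sub_distrib]
    refine (Finset.abs_sum_le_sum_abs _ _).trans ?_
    rw [Finset.mul_sum, Finset.mul_sum, Finset.mul_sum]
    refine Finset.sum_le_sum fun j _ => ?_
    rw [integral_comp_sub_of_support (f := fun t => IccExtend hL.le φ (t + a j) * v' j t)
      (ha0 j) (hahL j) (hz j)]
    have e1 : 2 * Real.pi * ((c j : ℝ) * φ (x j)) =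
        ∫ t in (0 : ℝ)..h j, IccExtend hL.le φ (x j) * v' j t := by
      rw [intervalIntegral.integral_const_mul, (hv j).integral_deriv, IccExtend_val]
      ring
    rw [e1, ← intervalIntegral.integral_sub (hi j) ((hv j).integrable.const_mul _),
      ← (hv j).integral_abs_deriv, ← mul_assoc K, ← intervalIntegral.integral_const_mul]
    refine (intervalIntegral.abs_integral_le_integral_abs (hv j).nonneg).trans
      (intervalIntegral.integral_mono_on (hv j).nonneg
        ((hi j).sub ((hv j).integrable.const_mul _)).abs ((hv j).integrable.abs.const_mul _)
        fun t ht => ?_)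
    rw [← sub_mul, abs_mul]
    refine mul_le_mul_of_nonneg_right ((hlip _ _).trans
      (mul_le_mul_of_nonneg_left ?_ hφ.nonneg_lip)) (abs_nonneg _)
    have h1 : |t + a j - x j| ≤ |t| + |a j - x j| := by
      rw [add_sub_assoc]
      exact abs_add_le _ _
    have h2 : |t| ≤ w := by
      rw [abs_of_nonneg ht.1]
      exact ht.2.trans (hhw j).le
    linarith [hax j]

/-! ### Curves with a prescribed angle -/

theorem IsH1.congr {F : Type*} [NormedAddCommGroup F] [NormedSpace ℝ F] {L : ℝ} {f g : ℝ → F}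
    (h : IsH1 L f) (hfg : EqOn g f (Icc 0 L)) : IsH1 L g := by
  have hd : EqOn (dx L g) (dx L f) (Icc 0 L) := fun x hx => derivWithin_congr hfg (hfg hx)
  refine ⟨(memLp_congr_ae ?_).2 h.1, fun x hx => ?_⟩
  · filter_upwards [self_mem_ae_restrict measurableSet_Icc] with x hx using hd hx
  · rw [hfg hx, hfg ⟨le_rfl, hx.1.trans hx.2⟩, h.2 x hx]
    congr 1
    refine intervalIntegral.integral_congr fun t ht => (hd ?_).symm
    rw [uIcc_of_le hx.1] at ht
    exact ⟨ht.1, ht.2.trans hx.2⟩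

/-- Lipschitz functions are of class `H¹`. The fundamental theorem of calculus for real functions
is applied to `g ∘ f` for all linear forms `g`. -/
theorem isH1_of_lipschitzWith {F : Type*} [NormedAddCommGroup F] [NormedSpace ℝ F]
    [FiniteDimensional ℝ F] {L : ℝ} {f : ℝ → F} {K : NNReal} (hf : LipschitzWith K f) :
    IsH1 L f := by
  have : CompleteSpace F := FiniteDimensional.complete ℝ F
  have : ProperSpace F := FiniteDimensional.proper ℝ F
  have hmem : MemLp (deriv f) 2 (volume.restrict (Icc 0 L)) :=
    MemLp.of_bound (aestronglyMeasurable_deriv f _) K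
      (Eventually.of_forall fun x => norm_deriv_le_of_lipschitz hf)
  have hae := dx_ae_eq_deriv L f
  refine ⟨(memLp_congr_ae hae).2 hmem, fun x hx => ?_⟩
  have hint : IntervalIntegrable (deriv f) volume 0 x :=
    (intervalIntegrable_iff_integrableOn_Icc_of_le hx.1).2
      ((hmem.integrable (by norm_num)).mono_measure (Measure.restrict_mono
        (Icc_subset_Icc_right hx.2) le_rfl))
  have e : ∫ t in (0 : ℝ)..x, dx L f t = ∫ t in (0 : ℝ)..x, deriv f t := by
    rw [intervalIntegral.integral_of_le hx.1, intervalIntegral.integral_of_le hx.1,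
      ← integral_Icc_eq_integral_Ioc, ← integral_Icc_eq_integral_Ioc]
    exact integral_congr_ae (ae_restrict_of_ae_restrict_of_subset (Icc_subset_Icc_right hx.2) hae)
  rw [e, ← sub_eq_iff_eq_add']
  refine (SeparatingDual.eq_iff_forall_dual_eq (R := ℝ)).2 fun g => ?_
  have hg := ((g.lipschitz.comp hf).lipschitzOnWith.absolutelyContinuousOnInterval
    (a := 0) (b := x)).integral_deriv_eq_sub
  simp only [Function.comp_apply] at hg
  rw [← g.intervalIntegral_comp_comm hint, map_sub, ← hg]
  refine intervalIntegral.integral_congr_ae ?_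
  filter_upwards [hf.ae_differentiableAt_real] with t ht _
  exact (g.hasFDerivAt.comp_hasDerivAt t ht.hasDerivAt).deriv

theorem lipschitzWith_circle :
    LipschitzWith 2 fun t : ℝ => (!₂[Real.cos t, Real.sin t] : Plane) := by
  refine LipschitzWith.of_dist_le_mul fun a b => ?_
  have h1 : dist (Real.cos a) (Real.cos b) ≤ dist a b := by
    simpa using Real.lipschitzWith_cos.dist_le_mul a b
  have h2 : dist (Real.sin a) (Real.sin b) ≤ dist a b := by
    simpa using Real.lipschitzWith_sin.dist_le_mul a b
  rw [EuclideanSpace.dist_eq]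
  refine Real.sqrt_le_iff.2 ⟨by positivity, ?_⟩
  simp only [Fin.sum_univ_two]
  simp only [Matrix.cons_val_zero, Matrix.cons_val_one, NNReal.coe_ofNat]
  have h3 := pow_le_pow_left₀ dist_nonneg h1 2
  have h4 := pow_le_pow_left₀ dist_nonneg h2 2
  nlinarith [sq_nonneg (dist a b)]

theorem norm_circle (t : ℝ) : ‖(!₂[Real.cos t, Real.sin t] : Plane)‖ = 1 := by
  simp [EuclideanSpace.norm_eq]

/-- The admissible curve with a given angle. The condition `∫ sin ψ = 0` makes the curve end on
the `x`-axis; the length is then determined by the end point. -/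
theorem exists_isAdmissible {p q : Plane} (hp : p 1 = 0) (hq : q 1 = 0) (hpq : p ≠ q)
    {ψ : ℝ → ℝ} {K : NNReal} (hψ : LipschitzWith K ψ) (h0 : ψ 0 = 0)
    (hlast : ∃ k : ℤ, ψ (dist p q) = 2 * Real.pi * k)
    (hsin : ∫ t in (0 : ℝ)..dist p q, Real.sin (ψ t) = 0)
    (hcos : 0 < ∫ t in (0 : ℝ)..dist p q, Real.cos (ψ t)) :
    ∃ Υ κ, IsAdmissible p q Υ κ ∧ IsAngle p q Υ κ ψ := by
  have hL : 0 < dist p q := dist_pos.2 hpq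
  have hsub := sub_eq_axisSign hp hq hpq
  have hs2 := axisSign_sq hp hq hpq
  set L := dist p q with hLdef
  set σ := axisSign p q with hσ
  set I := ∫ t in (0 : ℝ)..L, Real.cos (ψ t) with hI
  set ℓ : ℝ := L ^ 2 / I with hℓ
  have hℓ0 : 0 < ℓ := by positivity
  have hσabs : |σ| = 1 := by
    rw [← Real.sqrt_sq_eq_abs, hs2, Real.sqrt_one]
  set τ : ℝ → Plane := fun x => (ℓ / L * σ) • (!₂[Real.cos (ψ x), Real.sin (ψ x)] : Plane) with hτ
  have hτl : LipschitzWith (‖ℓ / L * σ‖₊ * (2 * K)) τ :=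
    (lipschitzWith_smul (ℓ / L * σ)).comp (lipschitzWith_circle.comp hψ)
  have hτc : Continuous τ := hτl.continuous
  have hτn : ∀ x, ‖τ x‖ = ℓ / L := fun x => by
    simp only [hτ]
    rw [norm_smul, norm_circle, mul_one, norm_mul, Real.norm_eq_abs σ, hσabs, mul_one,
      Real.norm_of_nonneg (by positivity)]
  set Υ : ℝ → Plane := fun x => p + ∫ t in (0 : ℝ)..x, τ t with hΥ
  have hderiv : ∀ x, HasDerivAt Υ (τ x) x := fun x =>
    (hτc.integral_hasStrictDerivAt 0 x).hasDerivAt.const_add p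
  have hdx : EqOn (dx L Υ) τ (Icc 0 L) := fun x hx =>
    (hderiv x).hasDerivWithinAt.derivWithin (uniqueDiffOn_Icc hL x hx)
  have hΥl : LipschitzWith (Real.toNNReal (ℓ / L)) Υ :=
    lipschitzWith_of_nnnorm_deriv_le (fun x => (hderiv x).differentiableAt) fun x => by
      rw [(hderiv x).deriv, ← NNReal.coe_le_coe, coe_nnnorm, hτn,
        Real.coe_toNNReal _ (by positivity)]
  have hlen : length L Υ = ℓ := by
    have e : ∫ x in (0 : ℝ)..L, ‖dx L Υ x‖ = ∫ x in (0 : ℝ)..L, ℓ / L :=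
      intervalIntegral.integral_congr fun x hx => by
        rw [hdx (by rwa [uIcc_of_le hL.le] at hx), hτn]
    rw [length, e, intervalIntegral.integral_const, sub_zero, smul_eq_mul]
    field_simp
  have hend : Υ L = q := by
    have e : q = p + (q - p) := by abel
    rw [e, hsub]
    simp only [hΥ]
    congr 1
    ext i
    rw [coord_integral (hτc.intervalIntegrable _ _)]
    fin_cases i
    · simp only [hτ, PiLp.smul_apply, smul_eq_mul]
      simp only [Fin.zero_eta, Matrix.cons_val_zero, intervalIntegral.integral_const_mul, mul_one]
      rw [← hI, hℓ]
      field_simp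
    · simp only [hτ, PiLp.smul_apply, smul_eq_mul]
      simp [hsin]
  obtain ⟨k, hk⟩ := hlast
  have hτ0 : τ 0 = (ℓ / L * σ) • (!₂[1, 0] : Plane) := by simp [hτ, h0]
  have hτL : τ L = (ℓ / L * σ) • (!₂[1, 0] : Plane) := by
    have e : 2 * Real.pi * (k : ℝ) = 0 + k * (2 * Real.pi) := by ring
    simp only [hτ]
    rw [hk, e, Real.cos_add_int_mul_two_pi, Real.sin_add_int_mul_two_pi, Real.cos_zero,
      Real.sin_zero]
  have hdx0 := hdx ⟨le_rfl, hL.le⟩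
  have hdxL := hdx ⟨hL.le, le_rfl⟩
  rw [hτ0] at hdx0
  rw [hτL] at hdxL
  have hforward : 0 < inner ℝ (q - p) ((ℓ / L * σ) • (!₂[1, 0] : Plane)) := by
    rw [hsub, inner_smul_left, inner_smul_right, real_inner_self_eq_norm_sq]
    have e : ‖(!₂[1, 0] : Plane)‖ = 1 := by simp [EuclideanSpace.norm_eq]
    rw [e]
    calc 0 < ℓ := hℓ0
      _ = ℓ * σ ^ 2 := by rw [hs2, mul_one]
      _ = _ := by
        simp only [conj_trivial]
        field_simp
  -- The lifting of the tangent is `ψ + θ₀`, where `θ₀` is the angle of `q - p`.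
  obtain ⟨θ₀, hc, hs⟩ : ∃ θ₀ : ℝ, Real.cos θ₀ = σ ∧ Real.sin θ₀ = 0 := by
    rcases eq_or_eq_neg_of_sq_eq_sq σ 1 (by rw [hs2, one_pow]) with h | h
    · exact ⟨0, by rw [h, Real.cos_zero], Real.sin_zero⟩
    · exact ⟨Real.pi, by rw [h, Real.cos_pi], Real.sin_pi⟩
  have hcurv : ∀ᵐ x ∂(volume.restrict (Icc 0 L)), L / ℓ * deriv ψ x =
      L / length L Υ * dx L (fun y => ψ y + θ₀) x := by
    filter_upwards [dx_ae_eq_deriv L fun y => ψ y + θ₀] with x hx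
    rw [hlen, hx, deriv_add_const]
  refine ⟨Υ, fun x => L / ℓ * deriv ψ x, ⟨⟨isH1_of_lipschitzWith hΥl,
    (isH1_of_lipschitzWith hτl).congr hdx⟩, fun x hx => ?_, ?_, hend, ?_, ?_, ?_, ?_,
    fun y => ψ y + θ₀, ?_, fun x hx => ?_, hcurv⟩, ?_, ?_, h0, ⟨k, hk⟩, ?_, ?_, ?_, fun x hx => ?_⟩
  · rw [hdx hx, hτn, hlen]
  · simp [hΥ]
  · rw [hdx0]
    simp
  · rw [hdxL]
    simp
  · rw [hdx0]
    exact hforward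
  · rw [hdxL]
    exact hforward
  · exact isH1_of_lipschitzWith (hψ.add (LipschitzWith.const θ₀))
  · rw [hdx hx, hlen, Real.cos_add, Real.sin_add, hc, hs]
    simp only [hτ]
    ext i
    fin_cases i <;> simp <;> ring
  · exact hψ.lipschitzOnWith.absolutelyContinuousOnInterval
  · exact (memLp_congr_ae (dx_ae_eq_deriv _ _)).1 (isH1_of_lipschitzWith hψ).1
  · rwa [hlen]
  · rw [hlen, ← hLdef, ← hI, hℓ]
    field_simp
  · exact Eventually.of_forall fun x => by rw [hlen]
  · rw [hdx hx, hlen]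

/-! ### Recovery families -/

/-- A curve close to a given pointed segment, for a fixed small `ε`. The transitions have the
parameters `s = ε^{1/2}` and `η = ε^{1/4}`, so that each of them fits in a window of length `w`, and
`B` bounds their energy. The first smallness condition gives enough room for the windows. The second
one makes `∫ cos ψ` positive, so that the curve can be scaled to end at `q`. -/
theorem exists_recovery_curve {p q : Plane} (hp : p 1 = 0) (hq : q 1 = 0) (hpq : p ≠ q) {ε : ℝ}
    (hε : 0 < ε) {N : ℕ} {x : Fin N → Icc (0 : ℝ) (dist p q)} (hx : Monotone x) (c : Fin N → ℤ)
    {M B w : ℝ} (hM : M = ∑ j, |(c j : ℝ)|) (hB : B = M * (8 * √2 + 4 * Real.pi * √(√ε)))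
    (hw : w = 2 * Real.pi * (M + 1) * √(√ε)) (hwL : N * w ≤ dist p q)
    (hBL : √ε * B ≤ dist p q / 2) :
    ∃ Υ κ, IsAdmissible p q Υ κ ∧
      energy p q ε Υ κ ≤ length (dist p q) Υ / dist p q * B ∧
      length (dist p q) Υ ≤ 2 * dist p q ∧
      ∀ (A K : ℝ) (φ : Icc (0 : ℝ) (dist p q) → ℝ), IsTest A K φ → A + K ≤ 1 →
        ∫ᵛ t, φ t ∂•(densityMeasure (dist p q) κ) - ∫ᵛ t, φ t ∂•(atomicMeasure x c) ≤
          ((N + 1) * w + (length (dist p q) Υ / dist p q - 1)) * (2 * Real.pi * M) := by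
  have hpi := Real.pi_pos
  have hL : 0 < dist p q := dist_pos.2 hpq
  have hs : 0 < √ε := Real.sqrt_pos.2 hε
  have hη : 0 < √(√ε) := Real.sqrt_pos.2 hs
  have hsη : √ε / √(√ε) = √(√ε) := Real.div_sqrt
  have hM0 : 0 ≤ M := by
    rw [hM]
    exact Finset.sum_nonneg fun j _ => abs_nonneg _
  have hw0 : 0 < w := by
    rw [hw]
    positivity
  obtain ⟨ψ, ⟨K₀, hlip⟩, h0, hlast, hsin, hen, htest⟩ := exists_recovery_angle hη hs hx c (w := w)
    (fun j => by
      have h1 : |(c j : ℝ)| ≤ M := by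
        rw [hM]
        exact Finset.single_le_sum (f := fun j => |(c j : ℝ)|) (fun i _ => abs_nonneg _)
          (Finset.mem_univ j)
      rw [hsη, hw]
      have h2 : 0 < 2 * Real.pi * √(√ε) := by positivity
      nlinarith) hwL hL
  rw [← hM] at hen htest
  rw [← hB] at hen
  have hcosc : Continuous fun t => Real.cos (ψ t) := Real.continuous_cos.comp hlip.continuous
  have hsq : IntervalIntegrable (fun t => deriv ψ t ^ 2) volume 0 (dist p q) :=
    (intervalIntegrable_iff_integrableOn_Icc_of_le hL.le).2
      ((memLp_congr_ae (dx_ae_eq_deriv _ _)).1 (isH1_of_lipschitzWith hlip).1).integrable_sq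
  have hpot : IntervalIntegrable (fun t => 1 - Real.cos (ψ t)) volume 0 (dist p q) :=
    (continuous_const.sub hcosc).intervalIntegrable _ _
  have hsq0 : 0 ≤ ∫ t in (0 : ℝ)..dist p q, deriv ψ t ^ 2 :=
    intervalIntegral.integral_nonneg hL.le fun _ _ => sq_nonneg _
  rw [intervalIntegral.integral_add (hsq.const_mul _) (hpot.const_mul _),
    intervalIntegral.integral_const_mul, intervalIntegral.integral_const_mul] at hen
  have hpotle : ∫ t in (0 : ℝ)..dist p q, (1 - Real.cos (ψ t)) ≤ dist p q / 2 := by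
    refine le_trans ?_ hBL
    have h1 : (√ε)⁻¹ * ∫ t in (0 : ℝ)..dist p q, (1 - Real.cos (ψ t)) ≤ B := by
      linarith [mul_nonneg hs.le hsq0]
    rwa [inv_mul_le_iff₀ hs] at h1
  have hcos : dist p q / 2 ≤ ∫ t in (0 : ℝ)..dist p q, Real.cos (ψ t) := by
    rw [intervalIntegral.integral_sub intervalIntegrable_const (hcosc.intervalIntegrable _ _)]
      at hpotle
    simp only [intervalIntegral.integral_const, sub_zero, smul_eq_mul, mul_one] at hpotle
    linarith
  obtain ⟨Υ, κ, hadm, hang⟩ := exists_isAdmissible hp hq hpq hlip h0 hlast hsin (by linarith)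
  have hℓ := hang.length_pos
  have hLℓ := hang.dist_le_length hpq
  have hr : 1 ≤ length (dist p q) Υ / dist p q := (one_le_div hL).2 hLℓ
  have hr' : dist p q / length (dist p q) Υ ≤ 1 := (div_le_one hℓ).2 hLℓ
  have hr0 : 0 ≤ dist p q / length (dist p q) Υ := by positivity
  have hrr : 1 - dist p q / length (dist p q) Υ ≤ length (dist p q) Υ / dist p q - 1 := by
    have h1 : dist p q / length (dist p q) Υ * (length (dist p q) Υ / dist p q) = 1 := by
      field_simp
    nlinarith
  refine ⟨Υ, κ, hadm, ?_, ?_, fun A K φ hφ hAK => ?_⟩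
  · rw [hang.energy_eq hpq, hang.length_sub_dist hpq]
    have h1 := mul_le_mul_of_nonneg_left hen (zero_le_one.trans hr)
    have h2 := mul_le_mul_of_nonneg_right (hr'.trans hr) (mul_nonneg hs.le hsq0)
    linarith
  · have h1 := mul_le_mul_of_nonneg_left hcos hℓ.le
    rw [hang.length_mul] at h1
    nlinarith
  · rw [hang.integral_curvature hφ, integral_atomicMeasure hφ]
    have h1 := htest A K φ hφ
    set J := ∫ t in (0 : ℝ)..dist p q, IccExtend hL.le φ t * deriv ψ t
    set S := 2 * Real.pi * ∑ j, (c j : ℝ) * φ (x j) with hS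
    have hA : A ≤ 1 := by linarith [hφ.nonneg_lip]
    have hK : K ≤ 1 := by linarith [hφ.nonneg_bound]
    have hSle : |S| ≤ 2 * Real.pi * M := by
      rw [hS, abs_mul, abs_of_pos (by positivity), hM]
      refine mul_le_mul_of_nonneg_left ((Finset.abs_sum_le_sum_abs _ _).trans
        (Finset.sum_le_sum fun j _ => ?_)) (by positivity)
      rw [abs_mul]
      exact mul_le_of_le_one_right (abs_nonneg _) ((hφ.bound _).trans hA)
    have h2 : K * ((N + 1) * w * (2 * Real.pi * M)) ≤ (N + 1) * w * (2 * Real.pi * M) :=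
      mul_le_of_le_one_left (by positivity) hK
    set r := dist p q / length (dist p q) Υ
    have h3 : r * (J - S) ≤ (N + 1) * w * (2 * Real.pi * M) :=
      (mul_le_mul_of_nonneg_left (le_abs_self _) hr0).trans
        ((mul_le_of_le_one_left (abs_nonneg _) hr').trans (h1.trans h2))
    have h4 : (1 - r) * (-S) ≤ (length (dist p q) Υ / dist p q - 1) * (2 * Real.pi * M) :=
      (mul_le_mul_of_nonneg_left ((neg_le_abs S).trans hSle) (by linarith)).trans
        (mul_le_mul_of_nonneg_right hrr (by positivity))
    linarith

/-- The recovery families. The energies are bounded from above by the construction, and from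
below by the lower bound for arbitrary sequences. -/
theorem exists_recovery {p q : Plane} (hp : p 1 = 0) (hq : q 1 = 0) (hpq : p ≠ q)
    {Υ₀ : ℝ → Plane} {μ : SignedMeasure (Icc (0 : ℝ) (dist p q))}
    (h₀ : IsPointedSegment p q Υ₀ μ) :
    ∃ (Υ : ℝ → ℝ → Plane) (κ : ℝ → ℝ → ℝ), (∀ ε, IsAdmissible p q (Υ ε) (κ ε)) ∧
      PairTendsto Υ (fun ε => densityMeasure (dist p q) (κ ε)) (𝓝[>] 0) Υ₀ μ ∧
      Tendsto (fun ε => ((energy p q ε (Υ ε) (κ ε) : ℝ) : EReal)) (𝓝[>] 0)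
        (𝓝 (((8 * √2 : ℝ) : EReal) * limitEnergy p q Υ₀ μ)) := by
  have hL : 0 < dist p q := dist_pos.2 hpq
  obtain ⟨N, x, c, hseg⟩ := h₀
  have hcurve : EqOn Υ₀ (segmentCurve p q) (Icc 0 (dist p q)) := hseg.1
  set M := ∑ j, |(c j : ℝ)| with hM
  set B : ℝ → ℝ := fun ε => M * (8 * √2 + 4 * Real.pi * √(√ε)) with hB
  set w : ℝ → ℝ := fun ε => 2 * Real.pi * (M + 1) * √(√ε) with hw
  have hBt : Tendsto B (𝓝[>] 0) (𝓝 (8 * √2 * M)) := by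
    have h1 : Continuous B := by fun_prop
    have h2 := (h1.tendsto 0).mono_left (nhdsWithin_le_nhds (s := Ioi 0))
    simpa [hB, mul_comm] using h2
  have hwt : Tendsto w (𝓝[>] 0) (𝓝 0) := by
    have h1 : Continuous w := by fun_prop
    have h2 := (h1.tendsto 0).mono_left (nhdsWithin_le_nhds (s := Ioi 0))
    simpa [hw] using h2
  have hst : Tendsto (fun ε : ℝ => √ε) (𝓝[>] 0) (𝓝 0) := by
    have h2 := (Real.continuous_sqrt.tendsto 0).mono_left (nhdsWithin_le_nhds (s := Ioi 0))
    simpa using h2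
  have hgood : ∀ᶠ ε in 𝓝[>] (0 : ℝ), 0 < ε ∧ N * w ε ≤ dist p q ∧ √ε * B ε ≤ dist p q / 2 := by
    refine Filter.Eventually.and self_mem_nhdsWithin (Filter.Eventually.and ?_ ?_)
    · have := hwt.const_mul (N : ℝ)
      rw [mul_zero] at this
      exact this.eventually_le_const hL
    · have := hst.mul hBt
      rw [zero_mul] at this
      exact this.eventually_le_const (half_pos hL)
  have hex : ∀ ε, ∃ Υ κ, IsAdmissible p q Υ κ ∧
      (0 < ε ∧ N * w ε ≤ dist p q ∧ √ε * B ε ≤ dist p q / 2 →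
        energy p q ε Υ κ ≤ length (dist p q) Υ / dist p q * B ε ∧
        length (dist p q) Υ ≤ 2 * dist p q ∧
        ∀ (A K : ℝ) (φ : Icc (0 : ℝ) (dist p q) → ℝ), IsTest A K φ → A + K ≤ 1 →
          ∫ᵛ t, φ t ∂•(densityMeasure (dist p q) κ) - ∫ᵛ t, φ t ∂•(atomicMeasure x c) ≤
            ((N + 1) * w ε + (length (dist p q) Υ / dist p q - 1)) * (2 * Real.pi * M)) :=
      fun ε => by
    by_cases hε : 0 < ε ∧ N * w ε ≤ dist p q ∧ √ε * B ε ≤ dist p q / 2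
    · obtain ⟨Υ, κ, h1, h2⟩ := exists_recovery_curve hp hq hpq hε.1 hseg.2.1.monotone c hM
        (B := B ε) rfl rfl hε.2.1 hε.2.2
      exact ⟨Υ, κ, h1, fun _ => h2⟩
    · -- There is no room for the transitions: the segment is admissible.
      obtain ⟨Υ, κ, h1, -⟩ := exists_isAdmissible hp hq hpq (ψ := fun _ => 0)
        (LipschitzWith.const 0) rfl ⟨0, by simp⟩ (by simp) (by simpa using hL)
      exact ⟨Υ, κ, h1, fun h => absurd h hε⟩
  choose Υ κ hadm hprop using hex
  have hlen : Tendsto (fun ε => length (dist p q) (Υ ε)) (𝓝[>] 0) (𝓝 (dist p q)) := by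
    refine tendsto_length hp hq hpq hadm (ε := id) (C := 2 * (8 * √2 * M + 1)) tendsto_id ?_
    filter_upwards [hgood, hBt.eventually_le_const (lt_add_one _)] with ε hε hBε
    obtain ⟨h1, h2, -⟩ := hprop ε hε
    have hM0 : 0 ≤ M := Finset.sum_nonneg fun j _ => abs_nonneg _
    have h3 : length (dist p q) (Υ ε) / dist p q ≤ 2 := (div_le_iff₀ hL).2 h2
    have h4 : 0 ≤ B ε := by positivity
    exact h1.trans (mul_le_mul h3 hBε h4 zero_le_two)
  have hratio : Tendsto (fun ε => length (dist p q) (Υ ε) / dist p q) (𝓝[>] 0) (𝓝 1) := by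
    have := hlen.div_const (dist p q)
    rwa [div_self hL.ne'] at this
  have hpair : PairTendsto Υ (fun ε => densityMeasure (dist p q) (κ ε)) (𝓝[>] 0) Υ₀ μ := by
    obtain ⟨h1, h2⟩ := tendsto_curves hp hq hpq hadm hlen hcurve
    refine ⟨h1, h2, ?_⟩
    rw [hseg.2.2]
    refine tendsto_flatNorm_of_le (δ := fun ε => ((N + 1) * w ε +
      (length (dist p q) (Υ ε) / dist p q - 1)) * (2 * Real.pi * M)) ?_
      (hgood.mono fun ε hε => (hprop ε hε).2.2)
    have h3 := ((hwt.const_mul ((N : ℝ) + 1)).add (hratio.sub_const 1)).mul_const (2 * Real.pi * M)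
    simpa using h3
  refine ⟨Υ, κ, hadm, hpair, tendsto_of_seq_tendsto fun u hu => ?_⟩
  have hH1 : IsH1 (dist p q) Υ₀ := by
    refine IsH1.congr (isH1_of_lipschitzWith (K := ‖(1 / dist p q) • (q - p)‖₊)
      (lipschitzWith_of_nnnorm_deriv_le (fun t => (hasDerivAt_segmentCurve p q t).differentiableAt)
        fun t => ?_)) hcurve
    rw [(hasDerivAt_segmentCurve p q t).deriv]
  have hlow := lower_bound hp hq hpq hu (fun n => hadm (u n)) hH1
    ⟨hpair.1.comp hu, hpair.2.1.comp hu, hpair.2.2.comp hu⟩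
  refine tendsto_of_le_liminf_of_limsup_le hlow ?_
  rw [limitEnergy_eq hseg, ← EReal.coe_mul]
  have hup : Tendsto (fun n => ((length (dist p q) (Υ (u n)) / dist p q * B (u n) : ℝ) : EReal))
      atTop (𝓝 ((8 * √2 * M : ℝ) : EReal)) := by
    have h1 := (hratio.mul hBt).comp hu
    rw [one_mul] at h1
    exact (continuous_coe_real_ereal.tendsto _).comp h1
  rw [← hup.limsup_eq]
  exact limsup_le_limsup ((hu.eventually hgood).mono fun n hn =>
    EReal.coe_le_coe_iff.2 (hprop (u n) hn).1)

end PointedCurve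

theorem theorem4p1 (p q : PointedCurve.Plane) (hp : p 1 = 0) (hq : q 1 = 0) (hpq : p ≠ q) :
    -- compactness
    (∀ (ε : ℕ → ℝ) (Υ : ℕ → ℝ → PointedCurve.Plane) (κ : ℕ → ℝ → ℝ),
      Tendsto ε atTop (𝓝[>] 0) →
      (∀ n, PointedCurve.IsAdmissible p q (Υ n) (κ n)) →
      (∃ C : ℝ, ∀ n, PointedCurve.energy p q (ε n) (Υ n) (κ n) ≤ C) →
      ∃ (k : ℕ → ℕ) (Υ₀ : ℝ → PointedCurve.Plane) (μ : SignedMeasure (Icc (0 : ℝ) (dist p q))),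
        StrictMono k ∧ PointedCurve.IsPointedSegment p q Υ₀ μ ∧
        PointedCurve.PairTendsto (fun n => Υ (k n))
          (fun n => PointedCurve.densityMeasure (dist p q) (κ (k n))) atTop Υ₀ μ) ∧
    -- lower bound
    (∀ (ε : ℕ → ℝ) (Υ : ℕ → ℝ → PointedCurve.Plane) (κ : ℕ → ℝ → ℝ)
      (Υ₀ : ℝ → PointedCurve.Plane) (μ : SignedMeasure (Icc (0 : ℝ) (dist p q))),
      Tendsto ε atTop (𝓝[>] 0) →
      (∀ n, PointedCurve.IsAdmissible p q (Υ n) (κ n)) →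
      PointedCurve.IsH1 (dist p q) Υ₀ →
      PointedCurve.PairTendsto Υ
        (fun n => PointedCurve.densityMeasure (dist p q) (κ n)) atTop Υ₀ μ →
      ((8 * √2 : ℝ) : EReal) * PointedCurve.limitEnergy p q Υ₀ μ ≤
        liminf (fun n => ((PointedCurve.energy p q (ε n) (Υ n) (κ n) : ℝ) : EReal)) atTop) ∧
    -- recovery families
    (∀ (Υ₀ : ℝ → PointedCurve.Plane) (μ : SignedMeasure (Icc (0 : ℝ) (dist p q))),
      PointedCurve.IsPointedSegment p q Υ₀ μ →
      ∃ (Υ : ℝ → ℝ → PointedCurve.Plane) (κ : ℝ → ℝ → ℝ),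
        (∀ ε ∈ Ioc (0 : ℝ) 1, PointedCurve.IsAdmissible p q (Υ ε) (κ ε)) ∧
        PointedCurve.PairTendsto Υ
          (fun ε => PointedCurve.densityMeasure (dist p q) (κ ε)) (𝓝[>] 0) Υ₀ μ ∧
        Tendsto (fun ε => ((PointedCurve.energy p q ε (Υ ε) (κ ε) : ℝ) : EReal)) (𝓝[>] 0)
          (𝓝 (((8 * √2 : ℝ) : EReal) * PointedCurve.limitEnergy p q Υ₀ μ))) := by
  refine ⟨fun ε Υ κ hε h ⟨C, hC⟩ => ?_, fun ε Υ κ Υ₀ μ hε h hΥ₀ hlim =>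
    PointedCurve.lower_bound hp hq hpq hε h hΥ₀ hlim, fun Υ₀ μ h₀ => ?_⟩
  · obtain ⟨k, N, x, c, hk, hx, hlim, -⟩ := PointedCurve.exists_subseq_tendsto hp hq hpq hε h hC
    exact ⟨k, PointedCurve.segmentCurve p q, PointedCurve.atomicMeasure x c, hk,
      ⟨N, x, c, fun _ _ => rfl, hx, rfl⟩, hlim⟩
  · obtain ⟨Υ, κ, h, hlim, hE⟩ := PointedCurve.exists_recovery hp hq hpq h₀
    exact ⟨Υ, κ, fun ε _ => h ε, hlim, hE⟩
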